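/- Let $t\in\mathbb C$. \textbf{The source category.} $\underline{\mathrm{Rep}}_0(H_t)$ has objects $[n]$, $n\in\mathbb N$, and $\mathrm{Hom}([k],[l])=\mathbb C P_{even}(k,l)$ is the vector space with basis the set partitions of $\{1,\dots,k,1',\dots,l'\}$ all of whose blocks have even size. Composition is the bilinear extension of $(q,p)\mapsto t^{\ell(q,p)}\,qp$, where $qp$ is obtained by stacking $q$ on top of $p$ and deleting the middle row, and $\ell(q,p)$ is the number of connected components of the stacking lying entirely in the middle row. The identity of $[n]$ is $\{\{1,1'\},\dots,\{n,n'\}\}$. \textbf{The target category.} $\mathrm{Par}(\mathbb Z_2,t)$ has objects $[\tilde n]$, $n\in\mathbb N$, and $\mathrm{Hom}([\tilde k],[\tilde l])$ is the vector space with basis the equivalence classes of $\mathbb Z_2$-coloured partitions: pairs $(p,z)$ of a set partition $p$ of $\{1,\dots,k,1',\dots,l'\}$ and a labelling $z$ of its elements by $\mathbb Z_2=\{1,-1\}$, up to multiplying, for each block, all labels in this block by a common sign. A pair of labelled partitions $(p,z_1)$ of size $(k,l)$ and $(q,z_2)$ of size $(l,m)$ is compatible if the function $i'\mapsto g(i')=z_1^{i'}z_2^{i'}$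 on the middle row is constant on the blocks of $q$; their product is then $qp$, where a bottom vertex $i$ is labelled by $z_1^{i}$ and a top vertex $j$ by $z_2^{j}g(i')$ for any middle vertex $i'$ in the block of $q$ containing $j$ (and by $z_2^j$ if there is none). The composite of two classes is $t^{\ell(q,p)}$ times the class of the product of compatible representatives if such exist, and $0$ otherwise; this is extended bilinearly. The identity of $[\tilde n]$ is $\{\{1,1'\},\dots,\{n,n'\}\}$ with all labels $1$, and $\otimes$ of morphisms is the bilinear extension of horizontal concatenation. $\mathrm{Par}(\mathbb Z_2,t)^{Kar}$ denotes the idempotent completion of the additive envelope of $\mathrm{Par}(\mathbb Z_2,t)$. \textbf{The functor.} Let $e'=\tfrac12(\mathrm{id}-\tau):[\tilde 1]\to[\tilde 1]$ in $\mathrm{Par}(\mathbb Z_2,2t)$, where $\tau$ is the partition $\{\{1,1'\}\}$ with $1$ labelled by $-1$ and $1'$ labelled by $1$. The $\mathbb C$-linear functor $\Omega_0:\underline{\mathrm{Rep}}_0(H_t)\to\mathrm{Par}(\mathbb Z_2,2t)^{Kar}$ is given by $\Omega_0([k])=([\tilde k],(e')^{\otimes k})$ and, for an even partition $f\in P_{even}(k,l)$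 with $s$ blocks of sizes $m_1,\dots,m_s$, $$\Omega_0(f)=2^{\frac{(\sum_{i=1}^s m_i)-2s}{2}}\,(e')^{\otimes l}\circ f\circ (e')^{\otimes k},$$ where on the right $f$ is coloured with all labels $1$. \textbf{Theorem.} For every $t\in\mathbb C$ the functor $\Omega_0:\underline{\mathrm{Rep}}_0(H_t)\to\mathrm{Par}(\mathbb Z_2,2t)^{Kar}$ is a full embedding, i.e. it is injective on objects, full and faithful. -/

import Mathlib

open CategoryTheory

noncomputable section

namespace HypOct

/-! ### Set partitions, stacking, loops

A partition of a set is encoded as the equivalence relation (`Setoid`) whose classes are the blocks.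
A partition of size `(k, l)` is a partition of `Fin k ⊕ Fin l`; the left summand is the bottom row
`1, …, k` and the right summand the top row `1', …, l'`. -/

section Partitions

variable {α β γ δ : Type}

/-- The bottom and middle rows inside three stacked rows. -/
def lo : α ⊕ β → α ⊕ β ⊕ γ := Sum.map id Sum.inl

/-- The middle and top rows inside three stacked rows. -/
def hi : β ⊕ γ → α ⊕ β ⊕ γ := Sum.inr

/-- The bottom and top rows inside three stacked rows. -/
def outer : α ⊕ γ → α ⊕ β ⊕ γ := Sum.map id Sum.inr

/-- The connected components of the stacking of `q` on top of `p`, the top row of `p` being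
identified with the bottom row of `q`. -/
def stack (p : Setoid (α ⊕ β)) (q : Setoid (β ⊕ γ)) : Setoid (α ⊕ β ⊕ γ) :=
  p.map lo ⊔ q.map hi

/-- The vertical concatenation `q p`. -/
def vcomp (p : Setoid (α ⊕ β)) (q : Setoid (β ⊕ γ)) : Setoid (α ⊕ γ) :=
  (stack p q).comap outer

/-- The number of loops: components of the stacking that lie entirely in the middle row. -/
def loops (p : Setoid (α ⊕ β)) (q : Setoid (β ⊕ γ)) : ℕ :=
  Nat.card {c : Quotient (stack p q) // ∀ x : α ⊕ γ, Quotient.mk _ (outer x) ≠ c}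

/-- The identity partition `{{1,1'}, …, {n,n'}}`. -/
def idPart (α : Type) : Setoid (α ⊕ α) := Setoid.ker (Sum.elim id id)

/-- A partition is even if each of its blocks has an even number of elements. -/
def IsEven (p : Setoid α) : Prop := ∀ c : Quotient p, Even (Nat.card {x : α // Quotient.mk p x = c})

/-- The number of blocks. -/
def numBlocks (p : Setoid α) : ℕ := Nat.card (Quotient p)

/-! ### `ℤ₂`-coloured partitions -/

/-- A partition with a labelling of its elements by `ℤ₂ = {1, -1}`. -/
@[ext] structure Labelled (α : Type) where
  part : Setoid α
  label : α → ℤˣ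

/-- Equivalence of coloured partitions: the underlying partitions agree, and in each block the
labels differ by a common factor. -/
instance labelledSetoid (α : Type) : Setoid (Labelled α) where
  r P Q := P.part = Q.part ∧ ∃ c : α → ℤˣ, (∀ x y, P.part x y → c x = c y) ∧
    ∀ x, Q.label x = c x * P.label x
  iseqv :=
    { refl := fun P => ⟨rfl, 1, by simp, by simp⟩
      symm := by
        rintro ⟨p, u⟩ ⟨q, v⟩ ⟨h, c, hc, hl⟩
        dsimp at h hc hl
        subst h
        exact ⟨rfl, c, hc, fun x => by simp [hl, ← mul_assoc]⟩
      trans := by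
        rintro ⟨p, u⟩ ⟨q, v⟩ ⟨r, w⟩ ⟨h, c, hc, hl⟩ ⟨h', c', hc', hl'⟩
        dsimp at h hc hl h' hc' hl'
        subst h; subst h'
        exact ⟨rfl, fun x => c' x * c x, fun x y hxy => by
            show c' x * c x = c' y * c y
            rw [hc x y hxy, hc' x y hxy],
          fun x => by simp [hl, hl', mul_assoc]⟩ }

/-- Equivalence classes of `ℤ₂`-coloured partitions of `α`. -/
abbrev Coloured (α : Type) : Type := Quotient (labelledSetoid α)

/-- The underlying partition of an equivalence class of coloured partitions. -/
def Coloured.part (P : Coloured α) : Setoid α :=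
  Quotient.lift Labelled.part (fun P Q (h : P.part = Q.part ∧ _) => h.1) P

/-- The partition `p` coloured by `u`. -/
def colour (p : Setoid α) (u : α → ℤˣ) : Coloured α := Quotient.mk _ ⟨p, u⟩

/-- Compatibility of `Q` (on top) with `P` (below): the products of the two labels of the middle
vertices are constant along the blocks of `Q`. -/
def Compatible (P : Labelled (α ⊕ β)) (Q : Labelled (β ⊕ γ)) : Prop :=
  ∀ i j : β, Q.part (Sum.inl i) (Sum.inl j) →
    P.label (Sum.inr i) * Q.label (Sum.inl i) = P.label (Sum.inr j) * Q.label (Sum.inl j)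

open Classical in
/-- The label of some middle vertex lying in the same block of `Q` as the top vertex `j`, and `1`
if there is none. -/
def middleLabel (P : Labelled (α ⊕ β)) (Q : Labelled (β ⊕ γ)) (j : γ) : ℤˣ :=
  if h : ∃ i : β, Q.part (Sum.inl i) (Sum.inr j) then
    P.label (Sum.inr h.choose) * Q.label (Sum.inl h.choose) else 1

/-- The vertical concatenation of two labelled partitions. -/
def Labelled.vcomp (P : Labelled (α ⊕ β)) (Q : Labelled (β ⊕ γ)) : Labelled (α ⊕ γ) where
  part := HypOct.vcomp P.part Q.part
  label := Sum.elim (fun i => P.label (Sum.inl i))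
    (fun j => Q.label (Sum.inr j) * middleLabel P Q j)

open Classical in
/-- The product of two equivalence classes of coloured partitions, together with its number of
loops: `some (l(q,p), qp)` if there are compatible representatives, and `none` otherwise. -/
def Coloured.mul (P : Coloured (α ⊕ β)) (Q : Coloured (β ⊕ γ)) : Option (ℕ × Coloured (α ⊕ γ)) :=
  if h : ∃ R : Labelled (α ⊕ β) × Labelled (β ⊕ γ),
      Quotient.mk _ R.1 = P ∧ Quotient.mk _ R.2 = Q ∧ Compatible R.1 R.2 then
    some (loops P.part Q.part, Quotient.mk _ (h.choose.1.vcomp h.choose.2))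
  else none

/-! Basic facts -/

/-- Sign functions that are constant on the blocks of `p`. -/
def signs (p : Setoid α) : Subgroup (α → ℤˣ) where
  carrier := {f | ∀ x y, p x y → f x = f y}
  mul_mem' := fun hf hg x y h => by simp [hf x y h, hg x y h]
  one_mem' := fun _ _ _ => rfl
  inv_mem' := fun hf x y h => by simp [hf x y h]

theorem mem_signs {p : Setoid α} {f : α → ℤˣ} : f ∈ signs p ↔ ∀ x y, p x y → f x = f y := Iff.rfl

theorem stack_le {p : Setoid (α ⊕ β)} {q : Setoid (β ⊕ γ)} {s : Setoid (α ⊕ β ⊕ γ)} :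
    stack p q ≤ s ↔ (∀ x y, p x y → s (lo x) (lo y)) ∧ ∀ x y, q x y → s (hi x) (hi y) := by
  rw [stack, sup_le_iff]
  refine and_congr ⟨fun h x y hxy => h (Relation.EqvGen.rel _ _ ⟨x, y, hxy, rfl, rfl⟩), fun h => ?_⟩
    ⟨fun h x y hxy => h (Relation.EqvGen.rel _ _ ⟨x, y, hxy, rfl, rfl⟩), fun h => ?_⟩
  · refine Setoid.eqvGen_le ?_
    rintro _ _ ⟨x, y, hxy, rfl, rfl⟩
    exact h x y hxy
  · refine Setoid.eqvGen_le ?_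
    rintro _ _ ⟨x, y, hxy, rfl, rfl⟩
    exact h x y hxy

theorem stack_lo {p : Setoid (α ⊕ β)} {q : Setoid (β ⊕ γ)} {x y} (h : p x y) :
    stack p q (lo x) (lo y) := (stack_le.1 le_rfl).1 x y h

theorem stack_hi {p : Setoid (α ⊕ β)} {q : Setoid (β ⊕ γ)} {x y} (h : q x y) :
    stack p q (hi x) (hi y) := (stack_le.1 le_rfl).2 x y h

theorem signs_stack {p : Setoid (α ⊕ β)} {q : Setoid (β ⊕ γ)} {f : α ⊕ β ⊕ γ → ℤˣ} :
    f ∈ signs (stack p q) ↔ f ∘ lo ∈ signs p ∧ f ∘ hi ∈ signs q := by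
  have := stack_le (p := p) (q := q) (s := Setoid.ker f)
  exact this

theorem signs_sep {p : Setoid α} {x y : α} (h : ∀ f ∈ signs p, f x = f y) : p x y := by
  classical
  by_contra hxy
  have := h (fun z => if p x z then -1 else 1) (fun a b hab => by
    have : p x a ↔ p x b := ⟨fun h => p.trans h hab, fun h => p.trans h (p.symm hab)⟩
    simp [this])
  simp [hxy] at this

theorem signs_injective {p q : Setoid α} (h : signs p = signs q) : p = q := by
  ext x y
  constructor
  · intro hxy
    exact signs_sep fun f hf => (h ▸ hf : f ∈ signs p) x y hxy
  · intro hxy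
    exact signs_sep fun f hf => (h ▸ hf : f ∈ signs q) x y hxy

/-- A sign function constant on the blocks of `vcomp p q` extends to the stacking. -/
theorem signs_vcomp_extend {p : Setoid (α ⊕ β)} {q : Setoid (β ⊕ γ)} {f : α ⊕ γ → ℤˣ}
    (hf : f ∈ signs (vcomp p q)) : ∃ g ∈ signs (stack p q), g ∘ outer = f := by
  classical
  refine ⟨fun w => if h : ∃ x, stack p q (outer x) w then f h.choose else 1, ?_, ?_⟩
  · intro w w' hw
    have hiff : ∀ x, stack p q (outer x) w ↔ stack p q (outer x) w' := fun x =>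
      ⟨fun h => Setoid.trans' _ h hw, fun h => Setoid.trans' _ h (Setoid.symm' _ hw)⟩
    by_cases h : ∃ x, stack p q (outer x) w
    · have h' : ∃ x, stack p q (outer x) w' := ⟨_, (hiff _).1 h.choose_spec⟩
      simp only [dif_pos h, dif_pos h']
      exact hf _ _ (Setoid.trans' (stack p q) h.choose_spec
        (Setoid.symm' (stack p q) ((hiff _).2 h'.choose_spec)))
    · have h' : ¬ ∃ x, stack p q (outer x) w' := fun ⟨x, hx⟩ => h ⟨x, (hiff x).2 hx⟩
      simp only [dif_neg h, dif_neg h']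
  · funext x
    have h : ∃ y, stack p q (outer y) (outer x) := ⟨x, Setoid.refl' _ _⟩
    simp only [Function.comp, dif_pos h]
    exact hf _ _ h.choose_spec

theorem signs_restrict {p : Setoid (α ⊕ β)} {q : Setoid (β ⊕ γ)} {g : α ⊕ β ⊕ γ → ℤˣ}
    (hg : g ∈ signs (stack p q)) : g ∘ outer ∈ signs (vcomp p q) :=
  fun _ _ h => hg _ _ h

@[simp] theorem colour_part (p : Setoid α) (u : α → ℤˣ) : (colour p u).part = p := rfl

theorem colour_eq {p : Setoid α} {u v : α → ℤˣ} :
    colour p u = colour p v ↔ v * u ∈ signs p := by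
  rw [colour, colour, Quotient.eq]
  constructor
  · rintro ⟨-, c, hc, hl⟩
    dsimp at hc hl
    have : v * u = c := by
      funext x
      simp [hl, mul_assoc]
    rw [this]; exact hc
  · intro h
    exact ⟨rfl, v * u, h, fun x => by simp [mul_assoc]⟩

theorem Coloured.ind {motive : Coloured α → Prop} (h : ∀ p u, motive (colour p u)) (P) : motive P :=
  Quotient.ind (fun ⟨p, u⟩ => h p u) P

/-- The labellings of the elements of `α` representing the class `P`. -/
def Coloured.Sol (P : Coloured α) : Set (α → ℤˣ) := {x | colour P.part x = P}

theorem mem_sol {p : Setoid α} {u x : α → ℤˣ} : x ∈ (colour p u).Sol ↔ u * x ∈ signs p := by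
  simp [Coloured.Sol, colour_eq]

theorem sol_injective {P Q : Coloured α} (h : P.Sol = Q.Sol) : P = Q := by
  induction P using Coloured.ind with | h p u =>
  induction Q using Coloured.ind with | h q v =>
  have hu : u ∈ (colour q v).Sol := by
    rw [← h, mem_sol]
    have : u * u = 1 := by funext x; simp
    rw [this]; exact one_mem _
  have hvu : colour q v = colour q u := by rw [colour_eq, mul_comm]; exact mem_sol.1 hu
  rw [hvu] at h ⊢
  have : p = q := signs_injective (by
    ext f
    have := Set.ext_iff.1 h (u * f)
    rw [mem_sol, mem_sol] at this
    have e : u * (u * f) = f := by funext x; simp [← mul_assoc]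
    rwa [e] at this)
  rw [this]

theorem sol_nonempty (P : Coloured α) : P.Sol.Nonempty := by
  induction P using Coloured.ind with | h p u =>
  exact ⟨u, by simp [Coloured.Sol]⟩

theorem colour_of_mem_sol {P : Coloured α} {x : α → ℤˣ} (h : x ∈ P.Sol) :
    colour P.part x = P := h

theorem Compatible.exists_lift {P : Labelled (α ⊕ β)} {Q : Labelled (β ⊕ γ)}
    (h : Compatible P Q) : ∃ w : α ⊕ β ⊕ γ → ℤˣ, w ∘ lo = P.label ∧
      Q.label * (w ∘ hi) ∈ signs Q.part ∧ w ∘ outer = (P.vcomp Q).label := by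
  classical
  refine ⟨Sum.elim (fun i => P.label (Sum.inl i)) (Sum.elim (fun i => P.label (Sum.inr i))
    (fun j => Q.label (Sum.inr j) * middleLabel P Q j)), ?_, ?_, ?_⟩
  · funext x; rcases x with x | x <;> rfl
  · have key : ∀ i j, Q.part (Sum.inl i) (Sum.inr j) →
        P.label (Sum.inr i) * Q.label (Sum.inl i) = middleLabel P Q j := by
      intro i j hij
      have he : ∃ i : β, Q.part (Sum.inl i) (Sum.inr j) := ⟨i, hij⟩
      rw [middleLabel, dif_pos he]
      exact h _ _ (Setoid.trans' _ hij (Setoid.symm' _ he.choose_spec))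
    have e : ∀ j, Q.label (Sum.inr j) * (Q.label (Sum.inr j) * middleLabel P Q j) =
        middleLabel P Q j := fun j => by simp [← mul_assoc]
    rintro (i | i) (j | j) hij
    · simpa [hi, mul_comm] using h i j hij
    · rw [Pi.mul_apply, Pi.mul_apply]; simpa [hi, e] using (mul_comm _ _).trans (key i j hij)
    · rw [Pi.mul_apply, Pi.mul_apply]; simpa [hi, e] using ((mul_comm _ _).trans (key j i (Setoid.symm' _ hij))).symm
    · have : middleLabel P Q i = middleLabel P Q j := by
        by_cases he : ∃ k : β, Q.part (Sum.inl k) (Sum.inr i)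
        · obtain ⟨k, hk⟩ := he
          rw [← key k i hk, ← key k j (Setoid.trans' _ hk hij)]
        · have he' : ¬ ∃ k : β, Q.part (Sum.inl k) (Sum.inr j) := fun ⟨k, hk⟩ =>
            he ⟨k, Setoid.trans' _ hk (Setoid.symm' _ hij)⟩
          rw [middleLabel, middleLabel, dif_neg he, dif_neg he']
      simpa [hi, e] using this
  · funext x; rcases x with x | x <;> rfl

theorem outer_unique {P : Coloured (α ⊕ β)} {Q : Coloured (β ⊕ γ)} {w w' : α ⊕ β ⊕ γ → ℤˣ}
    (h1 : w ∘ lo ∈ P.Sol) (h2 : w ∘ hi ∈ Q.Sol) (h1' : w' ∘ lo ∈ P.Sol) (h2' : w' ∘ hi ∈ Q.Sol) :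
    colour (vcomp P.part Q.part) (w ∘ outer) = colour (vcomp P.part Q.part) (w' ∘ outer) := by
  rw [colour_eq]
  have h : w' * w ∈ signs (stack P.part Q.part) := by
    rw [signs_stack]
    exact ⟨colour_eq.1 (Eq.trans h1 (Eq.symm h1')), colour_eq.1 (Eq.trans h2 (Eq.symm h2'))⟩
  exact signs_restrict h

/-- The product of two classes in terms of labellings of all three rows. -/
theorem mul_eq_of_sol {P : Coloured (α ⊕ β)} {Q : Coloured (β ⊕ γ)} {w : α ⊕ β ⊕ γ → ℤˣ}
    (h1 : w ∘ lo ∈ P.Sol) (h2 : w ∘ hi ∈ Q.Sol) :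
    P.mul Q = some (loops P.part Q.part, colour (vcomp P.part Q.part) (w ∘ outer)) := by
  have h : ∃ R : Labelled (α ⊕ β) × Labelled (β ⊕ γ),
      Quotient.mk _ R.1 = P ∧ Quotient.mk _ R.2 = Q ∧ Compatible R.1 R.2 :=
    ⟨(⟨P.part, w ∘ lo⟩, ⟨Q.part, w ∘ hi⟩), h1, h2, fun i j _ => by simp [lo, hi]⟩
  rw [Coloured.mul, dif_pos h]
  obtain ⟨e1, e2, hc⟩ := h.choose_spec
  generalize h.choose = R at e1 e2 hc
  obtain ⟨R1, R2⟩ := R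
  dsimp only at e1 e2 hc ⊢
  obtain ⟨w', l1, l2, l3⟩ := hc.exists_lift
  subst e1; subst e2
  congr 2
  have := outer_unique (P := Quotient.mk _ R1) (Q := Quotient.mk _ R2) (w := w') (w' := w)
    (by rw [l1]; rfl) (by
      refine (colour_eq (p := R2.part)).2 ?_
      exact l2) h1 h2
  rw [← this, l3]; rfl

theorem exists_sol_of_mul {P : Coloured (α ⊕ β)} {Q : Coloured (β ⊕ γ)}
    (h : P.mul Q ≠ none) : ∃ w : α ⊕ β ⊕ γ → ℤˣ, w ∘ lo ∈ P.Sol ∧ w ∘ hi ∈ Q.Sol := by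
  by_cases h' : ∃ R : Labelled (α ⊕ β) × Labelled (β ⊕ γ),
      Quotient.mk _ R.1 = P ∧ Quotient.mk _ R.2 = Q ∧ Compatible R.1 R.2
  · obtain ⟨⟨R1, R2⟩, rfl, rfl, hc⟩ := h'
    obtain ⟨w', l1, l2, l3⟩ := hc.exists_lift
    exact ⟨w', by rw [l1]; rfl, (colour_eq (p := R2.part)).2 l2⟩
  · rw [Coloured.mul, dif_neg h'] at h
    exact absurd rfl h

/-! Counting -/

theorem card_signs [Finite α] (p : Setoid α) : Nat.card (signs p) = 2 ^ numBlocks p := by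
  have e : signs p ≃ (Quotient p → ℤˣ) :=
    { toFun := fun f => Quotient.lift f.1 f.2
      invFun := fun g => ⟨fun x => g (Quotient.mk p x), fun x y h => congrArg g (Quotient.sound h)⟩
      left_inv := fun f => rfl
      right_inv := fun g => by funext c; induction c using Quotient.ind; rfl }
  rw [Nat.card_congr e, Nat.card_fun, numBlocks]
  simp

theorem numBlocks_stack [Finite α] [Finite β] [Finite γ] (p : Setoid (α ⊕ β)) (q : Setoid (β ⊕ γ)) :
    numBlocks (stack p q) = numBlocks (vcomp p q) + loops p q := by
  classical
  let F : Quotient (vcomp p q) → Quotient (stack p q) :=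
    Quotient.map outer (fun _ _ h => h)
  have hF : Function.Injective F := by
    intro a b hab
    induction a using Quotient.ind
    induction b using Quotient.ind
    exact Quotient.sound (Quotient.exact hab : _)
  have e1 : Quotient (vcomp p q) ≃ {c : Quotient (stack p q) // ¬ ∀ x : α ⊕ γ, Quotient.mk _ (outer x) ≠ c} :=
    (Equiv.ofInjective F hF).trans (Equiv.subtypeEquivRight (fun c => by
      constructor
      · rintro ⟨a, rfl⟩
        induction a using Quotient.ind with | _ a =>
        intro h
        exact h a rfl
      · intro h
        push Not at h
        obtain ⟨x, rfl⟩ := h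
        exact ⟨Quotient.mk _ x, rfl⟩))
  rw [numBlocks, numBlocks, loops, Nat.card_congr e1, add_comm, ← Nat.card_sum]
  exact Nat.card_congr (Equiv.sumCompl _).symm

theorem card_group_hom {G H : Type} [Group G] [Group H] (f : G →* H) :
    Nat.card G = Nat.card f.range * Nat.card f.ker := by
  rw [← Subgroup.index_ker, mul_comm, Subgroup.card_mul_index]

/-- The middle labellings of compatible fillings of two adjacent blocks. -/
def midHom (p : Setoid (α ⊕ β)) (q : Setoid (β ⊕ γ)) : signs p × signs q →* (β → ℤˣ) where
  toFun ab := fun i => ab.1.1 (Sum.inr i) * ab.2.1 (Sum.inl i)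
  map_one' := by funext i; simp
  map_mul' := fun a b => by funext i; simp [mul_mul_mul_comm]

theorem card_midHom_range [Finite α] [Finite β] [Finite γ] (p : Setoid (α ⊕ β))
    (q : Setoid (β ⊕ γ)) :
    2 ^ (numBlocks p + numBlocks q) =
      Nat.card (midHom p q).range * 2 ^ (numBlocks (vcomp p q) + loops p q) := by
  have h := card_group_hom (midHom p q)
  have e : (midHom p q).ker ≃ signs (stack p q) :=
    { toFun := fun ab => ⟨Sum.elim (fun i => ab.1.1.1 (Sum.inl i)) ab.1.2.1, by
        have hab : ∀ i, ab.1.1.1 (Sum.inr i) = ab.1.2.1 (Sum.inl i) := fun i => by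
          have := congrFun (MonoidHom.mem_ker.1 ab.2) i
          simpa [midHom, mul_eq_one_iff_eq_inv] using this
        rw [signs_stack]
        refine ⟨?_, ab.1.2.2⟩
        convert ab.1.1.2 using 1
        funext x
        rcases x with x | x
        · rfl
        · simp [lo, hab]⟩
      invFun := fun f => ⟨(⟨f.1 ∘ lo, (signs_stack.1 f.2).1⟩, ⟨f.1 ∘ hi, (signs_stack.1 f.2).2⟩), by
        rw [MonoidHom.mem_ker]
        funext i
        simp [midHom, lo, hi]⟩
      left_inv := by
        rintro ⟨⟨⟨a, ha⟩, ⟨b, hb⟩⟩, hab⟩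
        have hab' : ∀ i, a (Sum.inr i) = b (Sum.inl i) := fun i => by
          have := congrFun (MonoidHom.mem_ker.1 hab) i
          simpa [midHom, mul_eq_one_iff_eq_inv] using this
        ext x
        · rcases x with x | x
          · rfl
          · simp [lo, hab']
        · rfl
      right_inv := by
        rintro ⟨f, hf⟩
        ext x
        rcases x with x | x <;> rfl }
  rw [Nat.card_congr e, card_signs, Nat.card_prod, card_signs, card_signs, numBlocks_stack,
    ← pow_add] at h
  exact h

/-- Restriction of sign functions from the stacking to the outer rows. -/
def outHom (p : Setoid (α ⊕ β)) (q : Setoid (β ⊕ γ)) : signs (stack p q) →* signs (vcomp p q) where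
  toFun f := ⟨f.1 ∘ outer, signs_restrict f.2⟩
  map_one' := rfl
  map_mul' := fun _ _ => rfl

theorem card_outHom_ker [Finite α] [Finite β] [Finite γ] (p : Setoid (α ⊕ β)) (q : Setoid (β ⊕ γ)) :
    Nat.card (outHom p q).ker = 2 ^ loops p q := by
  have h := card_group_hom (outHom p q)
  have hs : Function.Surjective (outHom p q) := by
    rintro ⟨f, hf⟩
    obtain ⟨g, hg, rfl⟩ := signs_vcomp_extend hf
    exact ⟨⟨g, hg⟩, rfl⟩
  rw [MonoidHom.range_eq_top.2 hs, card_signs, numBlocks_stack, Subgroup.card_top, card_signs,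
    pow_add] at h
  exact (Nat.eq_of_mul_eq_mul_left (by positivity) h).symm

theorem card_fibre [Finite α] [Finite β] [Finite γ] (P : Coloured (α ⊕ β)) (Q : Coloured (β ⊕ γ))
    (x : α → ℤˣ) (z : γ → ℤˣ) (y₀ : β → ℤˣ)
    (h₀ : Sum.elim x y₀ ∈ P.Sol ∧ Sum.elim y₀ z ∈ Q.Sol) :
    Nat.card {y : β → ℤˣ // Sum.elim x y ∈ P.Sol ∧ Sum.elim y z ∈ Q.Sol} =
      2 ^ loops P.part Q.part := by
  rw [← card_outHom_ker]
  have aux : ∀ y : β → ℤˣ, (Sum.elim x y ∈ P.Sol ∧ Sum.elim y z ∈ Q.Sol) ↔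
      (Sum.elim (1 : α → ℤˣ) (y * y₀) ∈ signs P.part ∧
        Sum.elim (y * y₀) (1 : γ → ℤˣ) ∈ signs Q.part) := by
    intro y
    have e1 : (Sum.elim 1 (y * y₀) : α ⊕ β → ℤˣ) = Sum.elim x y₀ * Sum.elim x y := by
      funext i; rcases i with i | i <;> simp [mul_comm]
    have e2 : (Sum.elim (y * y₀) 1 : β ⊕ γ → ℤˣ) = Sum.elim y₀ z * Sum.elim y z := by
      funext i; rcases i with i | i <;> simp [mul_comm]
    rw [e1, e2, ← mem_sol, ← mem_sol, colour_of_mem_sol h₀.1, colour_of_mem_sol h₀.2]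
  have hyy : ∀ y : β → ℤˣ, y * y₀ * y₀ = y := fun y => by funext i; simp [mul_assoc]
  refine Nat.card_congr ?_
  exact
    { toFun := fun y => ⟨⟨Sum.elim 1 (Sum.elim (y.1 * y₀) 1), by
          rw [signs_stack]
          have := (aux y.1).1 y.2
          refine ⟨?_, this.2⟩
          convert this.1 using 1
          funext i; rcases i with i | i <;> rfl⟩, by
          rw [MonoidHom.mem_ker]
          ext i; rcases i with i | i <;> rfl⟩
      invFun := fun f => ⟨(fun i => f.1.1 (Sum.inr (Sum.inl i))) * y₀, by
          rw [aux, hyy]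
          have h1 := f.1.2
          rw [signs_stack] at h1
          have h2 := congrArg Subtype.val (MonoidHom.mem_ker.1 f.2)
          constructor
          · convert h1.1 using 1
            funext i
            rcases i with i | i
            · exact (congrFun h2 (Sum.inl i)).symm
            · rfl
          · convert h1.2 using 1
            funext i
            rcases i with i | i
            · rfl
            · exact (congrFun h2 (Sum.inr i)).symm⟩
      left_inv := fun y => Subtype.ext (hyy y.1)
      right_inv := by
        rintro ⟨⟨f, hf⟩, hk⟩
        have h2 := congrArg Subtype.val (MonoidHom.mem_ker.1 hk)
        ext i
        rcases i with i | i | i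
        · exact congrArg _ (congrFun h2 (Sum.inl i)).symm
        · have := congrFun (hyy (fun i => f (Sum.inr (Sum.inl i)))) i
          exact congrArg _ this
        · exact congrArg _ (congrFun h2 (Sum.inr i)).symm }

end Partitions

end HypOct

namespace HypOct

section Assoc

variable {α β γ δ : Type}

theorem sol_mul {P : Coloured α} {x f : α → ℤˣ} (hx : x ∈ P.Sol) (hf : f ∈ signs P.part) :
    x * f ∈ P.Sol := by
  rw [← colour_of_mem_sol hx, mem_sol, ← mul_assoc]
  have : x * x = 1 := by funext i; simp
  rw [this, one_mul]; exact hf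

open Classical in
/-- The indicator matrix of the labellings representing `P`. -/
def mat (P : Coloured (α ⊕ β)) : Matrix (α → ℤˣ) (β → ℤˣ) ℕ :=
  fun x y => if Sum.elim x y ∈ P.Sol then 1 else 0

def omat (o : Option (ℕ × Coloured (α ⊕ β))) : Matrix (α → ℤˣ) (β → ℤˣ) ℕ :=
  o.elim 0 (fun A => 2 ^ A.1 • mat A.2)

theorem mat_apply {P : Coloured (α ⊕ β)} {x : α ⊕ β → ℤˣ} :
    mat P (x ∘ Sum.inl) (x ∘ Sum.inr) ≠ 0 ↔ x ∈ P.Sol := by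
  simp [mat]

theorem omat_injective : Function.Injective (omat (α := α) (β := β)) := by
  rintro (_ | ⟨n, P⟩) (_ | ⟨m, Q⟩) h
  · rfl
  · obtain ⟨x, hx⟩ := sol_nonempty Q
    have h1 := congrFun (congrFun h (x ∘ Sum.inl)) (x ∘ Sum.inr)
    exact absurd h1.symm (mul_ne_zero (by positivity) (mat_apply.2 hx))
  · obtain ⟨x, hx⟩ := sol_nonempty P
    have h1 := congrFun (congrFun h (x ∘ Sum.inl)) (x ∘ Sum.inr)
    exact absurd h1 (mul_ne_zero (by positivity) (mat_apply.2 hx))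
  · have hs : P = Q := by
      apply sol_injective
      ext x
      have h1 := congrFun (congrFun h (x ∘ Sum.inl)) (x ∘ Sum.inr)
      have h2 : 2 ^ n * mat P (x ∘ Sum.inl) (x ∘ Sum.inr) =
        2 ^ m * mat Q (x ∘ Sum.inl) (x ∘ Sum.inr) := h1
      rw [← mat_apply, ← mat_apply]
      constructor
      · intro h3 h4
        rw [h4, mul_zero] at h2
        exact mul_ne_zero (by positivity) h3 h2
      · intro h3 h4
        rw [h4, mul_zero] at h2
        exact mul_ne_zero (by positivity) h3 h2.symm
    subst hs
    obtain ⟨x, hx⟩ := sol_nonempty P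
    have h1 := congrFun (congrFun h (x ∘ Sum.inl)) (x ∘ Sum.inr)
    have h2 : 2 ^ n * mat P (x ∘ Sum.inl) (x ∘ Sum.inr) =
        2 ^ m * mat P (x ∘ Sum.inl) (x ∘ Sum.inr) := h1
    have h3 := Nat.eq_of_mul_eq_mul_right (Nat.pos_of_ne_zero (mat_apply.2 hx)) h2
    rw [Nat.pow_right_injective le_rfl h3]

theorem omat_mul [Finite α] [Fintype β] [DecidableEq β] [Finite γ]
    (P : Coloured (α ⊕ β)) (Q : Coloured (β ⊕ γ)) :
    omat (P.mul Q) = mat P * mat Q := by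
  classical
  ext x z
  have hR : (mat P * mat Q) x z =
      Nat.card {y : β → ℤˣ // Sum.elim x y ∈ P.Sol ∧ Sum.elim y z ∈ Q.Sol} := by
    rw [Matrix.mul_apply, Nat.card_eq_fintype_card, Fintype.card_subtype, Finset.card_filter]
    refine Finset.sum_congr rfl fun y _ => ?_
    simp only [mat]
    split_ifs <;> simp_all
  rw [hR]
  by_cases h : ∃ y : β → ℤˣ, Sum.elim x y ∈ P.Sol ∧ Sum.elim y z ∈ Q.Sol
  · obtain ⟨y, hy⟩ := h
    rw [card_fibre P Q x z y hy]
    have e1 : (Sum.elim x (Sum.elim y z) : α ⊕ β ⊕ γ → ℤˣ) ∘ lo = Sum.elim x y := by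
      funext i; rcases i with i | i <;> rfl
    have e2 : (Sum.elim x (Sum.elim y z) : α ⊕ β ⊕ γ → ℤˣ) ∘ outer = Sum.elim x z := by
      funext i; rcases i with i | i <;> rfl
    rw [mul_eq_of_sol (w := Sum.elim x (Sum.elim y z)) (by rw [e1]; exact hy.1) hy.2, e2]
    show 2 ^ _ * mat _ x z = _
    have : Sum.elim x z ∈ (colour (vcomp P.part Q.part) (Sum.elim x z)).Sol := rfl
    rw [mat, if_pos this, mul_one]
  · have : IsEmpty {y : β → ℤˣ // Sum.elim x y ∈ P.Sol ∧ Sum.elim y z ∈ Q.Sol} :=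
      ⟨fun y => h ⟨y.1, y.2⟩⟩
    rw [Nat.card_of_isEmpty]
    by_cases hn : P.mul Q = none
    · rw [hn]; rfl
    · obtain ⟨w, h1, h2⟩ := exists_sol_of_mul hn
      rw [mul_eq_of_sol h1 h2]
      show 2 ^ _ * mat _ x z = _
      rw [mat, if_neg, mul_zero]
      intro hs
      rw [mem_sol] at hs
      obtain ⟨g, hg, hgo⟩ := signs_vcomp_extend hs
      rw [signs_stack] at hg
      have s1 := sol_mul h1 hg.1
      have s2 := sol_mul h2 hg.2
      have hw : ∀ i, w (outer i) * g (outer i) = Sum.elim x z i := fun i => by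
        have := congrFun hgo i
        simp only [Function.comp] at this
        rw [this]; simp [← mul_assoc]
      refine h ⟨fun i => w (Sum.inr (Sum.inl i)) * g (Sum.inr (Sum.inl i)), ?_, ?_⟩
      · convert s1 using 1
        funext i
        rcases i with i | i
        · exact (hw (Sum.inl i)).symm
        · rfl
      · convert s2 using 1
        funext i
        rcases i with i | i
        · rfl
        · exact (hw (Sum.inr i)).symm

theorem mul_assoc_coloured [Finite α] [Finite β] [Finite γ] [Finite δ]
    (P : Coloured (α ⊕ β)) (Q : Coloured (β ⊕ γ)) (R : Coloured (γ ⊕ δ)) :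
    ((P.mul Q).bind fun A => (A.2.mul R).map fun B => (A.1 + B.1, B.2)) =
      (Q.mul R).bind fun A => (P.mul A.2).map fun B => (A.1 + B.1, B.2) := by
  classical
  have := Fintype.ofFinite β
  have := Fintype.ofFinite γ
  apply omat_injective
  have hm : ∀ (n : ℕ) (o : Option (ℕ × Coloured (α ⊕ δ))),
      omat (o.map fun B => (n + B.1, B.2)) = 2 ^ n • omat o := by
    rintro n (_ | ⟨m, B⟩)
    · exact (smul_zero _).symm
    · simp [omat, pow_add, mul_smul]
  have hl : omat ((P.mul Q).bind fun A => (A.2.mul R).map fun B => (A.1 + B.1, B.2)) =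
      mat P * mat Q * mat R := by
    rw [← omat_mul P Q]
    rcases P.mul Q with _ | ⟨n, A⟩
    · simp [omat]
    · rw [Option.bind_some, hm, omat_mul]
      simp [omat]
  have hr : omat ((Q.mul R).bind fun A => (P.mul A.2).map fun B => (A.1 + B.1, B.2)) =
      mat P * (mat Q * mat R) := by
    rw [← omat_mul Q R]
    rcases Q.mul R with _ | ⟨n, A⟩
    · simp [omat]
    · rw [Option.bind_some, hm, omat_mul]
      simp [omat]
  rw [hl, hr, Matrix.mul_assoc]

theorem vcomp_idPart_left (p : Setoid (α ⊕ β)) : vcomp (idPart α) p = p := by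
  apply le_antisymm
  · have h : stack (idPart α) p ≤ p.comap (Sum.elim Sum.inl id) := by
      rw [stack_le]
      refine ⟨?_, fun x y h => h⟩
      rintro (x | x) (y | y) h <;> cases h <;> exact Setoid.refl' p _
    intro x y hxy
    have := h hxy
    rcases x with x | x <;> rcases y with y | y <;> exact this
  · have h0 : ∀ x, stack (idPart α) p (outer x) (hi x) := by
      rintro (x | x)
      · exact stack_lo (x := Sum.inl x) (y := Sum.inr x) rfl
      · exact Setoid.refl' _ _
    intro x y hxy
    exact Setoid.trans' (stack _ _) (h0 x)
      (Setoid.trans' (stack _ _) (stack_hi hxy) (Setoid.symm' (stack _ _) (h0 y)))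

theorem loops_idPart_left (p : Setoid (α ⊕ β)) : loops (idPart α) p = 0 := by
  have : IsEmpty {c : Quotient (stack (idPart α) p) // ∀ x : α ⊕ β, Quotient.mk _ (outer x) ≠ c} := by
    refine ⟨?_⟩
    rintro ⟨c, hc⟩
    induction c using Quotient.ind with | _ w =>
    rcases w with w | w | w
    · exact hc (Sum.inl w) rfl
    · exact hc (Sum.inl w) (Quotient.sound (stack_lo (x := Sum.inl w) (y := Sum.inr w) rfl))
    · exact hc (Sum.inr w) rfl
  rw [loops, Nat.card_of_isEmpty]

theorem vcomp_idPart_right (p : Setoid (α ⊕ β)) : vcomp p (idPart β) = p := by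
  apply le_antisymm
  · have h : stack p (idPart β) ≤ p.comap (Sum.elim Sum.inl (Sum.elim Sum.inr Sum.inr)) := by
      rw [stack_le]
      constructor
      · intro x y h
        rcases x with x | x <;> rcases y with y | y <;> exact h
      · rintro (x | x) (y | y) h <;> cases h <;> exact Setoid.refl' p _
    intro x y hxy
    have := h hxy
    rcases x with x | x <;> rcases y with y | y <;> exact this
  · have h0 : ∀ x, stack p (idPart β) (outer x) (lo x) := by
      rintro (x | x)
      · exact Setoid.refl' _ _
      · exact stack_hi (x := Sum.inr x) (y := Sum.inl x) rfl
    intro x y hxy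
    exact Setoid.trans' (stack _ _) (h0 x)
      (Setoid.trans' (stack _ _) (stack_lo hxy) (Setoid.symm' (stack _ _) (h0 y)))

theorem loops_idPart_right (p : Setoid (α ⊕ β)) : loops p (idPart β) = 0 := by
  have : IsEmpty {c : Quotient (stack p (idPart β)) // ∀ x : α ⊕ β, Quotient.mk _ (outer x) ≠ c} := by
    refine ⟨?_⟩
    rintro ⟨c, hc⟩
    induction c using Quotient.ind with | _ w =>
    rcases w with w | w | w
    · exact hc (Sum.inl w) rfl
    · exact hc (Sum.inr w) (Quotient.sound (stack_hi (x := Sum.inr w) (y := Sum.inl w) rfl))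
    · exact hc (Sum.inr w) rfl
  rw [loops, Nat.card_of_isEmpty]

theorem mem_sol_self (p : Setoid α) (u : α → ℤˣ) : u ∈ (colour p u).Sol := rfl

theorem id_mul_coloured (z : α → ℤˣ) (p : Setoid (α ⊕ β)) (u : α ⊕ β → ℤˣ) :
    (colour (idPart α) (Sum.elim z 1)).mul (colour p u) =
      some (0, colour p (u * Sum.elim z 1)) := by
  have h := mul_eq_of_sol (P := colour (idPart α) (Sum.elim z 1)) (Q := colour p u)
    (w := Sum.elim (fun i => z i * u (Sum.inl i)) u) (by
      rw [mem_sol]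
      rintro (x | x) (y | y) h <;> cases h <;> simp [lo, ← mul_assoc]) (mem_sol_self p u)
  rw [h, colour_part, colour_part, loops_idPart_left, vcomp_idPart_left]
  congr 3
  funext i
  rcases i with i | i
  · exact mul_comm _ _
  · exact (mul_one _).symm

theorem mul_id_coloured (z : β → ℤˣ) (p : Setoid (α ⊕ β)) (u : α ⊕ β → ℤˣ) :
    (colour p u).mul (colour (idPart β) (Sum.elim z 1)) =
      some (0, colour p (u * Sum.elim (1 : α → ℤˣ) z)) := by
  have h := mul_eq_of_sol (P := colour p u) (Q := colour (idPart β) (Sum.elim z 1))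
    (w := Sum.elim (fun i => u (Sum.inl i)) (Sum.elim (fun i => u (Sum.inr i))
      (fun i => u (Sum.inr i) * z i)))
    (by
      convert mem_sol_self p u using 1
      funext i; rcases i with i | i <;> rfl)
    (by
      rw [mem_sol]
      rintro (x | x) (y | y) h <;> cases h <;> simp [hi, mul_comm])
  rw [h, colour_part, colour_part, loops_idPart_right, vcomp_idPart_right]
  congr 3
  funext i
  rcases i with i | i
  · exact (mul_one _).symm
  · rfl

theorem mul_trivial (p : Setoid (α ⊕ β)) (q : Setoid (β ⊕ γ)) :
    (colour p 1).mul (colour q 1) = some (loops p q, colour (vcomp p q) 1) :=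
  mul_eq_of_sol (P := colour p 1) (Q := colour q 1) (w := 1) (mem_sol_self p 1) (mem_sol_self q 1)

theorem colour_one_injective : Function.Injective (fun p : Setoid α => colour p 1) :=
  fun _ _ h => congrArg Coloured.part h

theorem vcomp_assoc [Finite α] [Finite β] [Finite γ] [Finite δ]
    (p : Setoid (α ⊕ β)) (q : Setoid (β ⊕ γ)) (r : Setoid (γ ⊕ δ)) :
    loops p q + loops (vcomp p q) r = loops q r + loops p (vcomp q r) ∧
      vcomp (vcomp p q) r = vcomp p (vcomp q r) := by
  have h := mul_assoc_coloured (colour p 1) (colour q 1) (colour r 1)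
  simp only [mul_trivial, Option.bind_some, Option.map_some, Option.some.injEq,
    Prod.mk.injEq] at h
  exact ⟨h.1, colour_one_injective h.2⟩

theorem isEven_iff [Fintype α] (p : Setoid α) : IsEven p ↔ ∀ f ∈ signs p, ∏ x, f x = 1 := by
  classical
  have : Fintype (Quotient p) := Fintype.ofFinite _
  constructor
  · intro h f hf
    rw [← Fintype.prod_fiberwise (fun x => Quotient.mk p x)]
    refine Finset.prod_eq_one fun c _ => ?_
    induction c using Quotient.ind with | _ y =>
    have : ∀ x : {x // Quotient.mk p x = Quotient.mk p y}, f x = f y := fun x =>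
      hf _ _ (Quotient.exact x.2)
    rw [Finset.prod_congr rfl (fun x _ => this x), Finset.prod_const, Finset.card_univ,
      ← Nat.card_eq_fintype_card]
    obtain ⟨m, hm⟩ := h (Quotient.mk p y)
    rw [hm, ← two_mul, pow_mul, Int.units_sq, one_pow]
  · intro h c
    have := h (fun x => if Quotient.mk p x = c then -1 else 1) (fun x y hxy => by
      have : Quotient.mk p x = Quotient.mk p y := Quotient.sound hxy
      simp only [this])
    rw [Finset.prod_ite, Finset.prod_const, Finset.prod_const_one, mul_one] at this
    rw [Nat.card_eq_fintype_card, Fintype.card_subtype]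
    by_contra ho
    rw [Nat.not_even_iff_odd] at ho
    rw [ho.neg_one_pow] at this
    exact absurd this (by decide)

theorem isEven_vcomp [Finite α] [Finite β] [Finite γ] {p : Setoid (α ⊕ β)} {q : Setoid (β ⊕ γ)}
    (hp : IsEven p) (hq : IsEven q) : IsEven (vcomp p q) := by
  have := Fintype.ofFinite α
  have := Fintype.ofFinite β
  have := Fintype.ofFinite γ
  rw [isEven_iff] at *
  intro f hf
  obtain ⟨g, hg, rfl⟩ := signs_vcomp_extend hf
  rw [signs_stack] at hg
  have h1 := hp _ hg.1
  have h2 := hq _ hg.2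
  rw [Fintype.prod_sum_type] at h1 h2 ⊢
  have h3 : ∏ x, (g ∘ lo) (Sum.inr x : α ⊕ β) = ∏ x, (g ∘ hi) (Sum.inl x : β ⊕ γ) := rfl
  have h4 : (∏ x, (g ∘ lo) (Sum.inl x : α ⊕ β)) = ∏ x, (g ∘ outer) (Sum.inl x : α ⊕ γ) := rfl
  have h5 : (∏ x, (g ∘ hi) (Sum.inr x : β ⊕ γ)) = ∏ x, (g ∘ outer) (Sum.inr x : α ⊕ γ) := rfl
  rw [← h4, ← h5]
  rw [h3] at h1
  calc _ = (∏ x, (g ∘ lo) (Sum.inl x : α ⊕ β)) * ((∏ x, (g ∘ hi) (Sum.inl x : β ⊕ γ)) *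
        (∏ x, (g ∘ hi) (Sum.inl x : β ⊕ γ))) * ∏ x, (g ∘ hi) (Sum.inr x : β ⊕ γ) := by
        rw [Int.units_mul_self, mul_one]
    _ = 1 := by rw [← mul_assoc, h1, one_mul, h2]

theorem isEven_idPart [Finite α] : IsEven (idPart α) := by
  have := Fintype.ofFinite α
  rw [isEven_iff]
  intro f hf
  rw [Fintype.prod_sum_type, ← Finset.prod_mul_distrib]
  refine Finset.prod_eq_one fun x _ => ?_
  rw [hf (Sum.inl x) (Sum.inr x) rfl, Int.units_mul_self]

end Assoc

end HypOct

namespace HypOct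

/-! ### Horizontal concatenation -/

section Tensor

variable {α β : Type}

/-- Juxtaposition of two partitions. -/
def sumPart (p : Setoid α) (q : Setoid β) : Setoid (α ⊕ β) where
  r := Sum.LiftRel p q
  iseqv :=
    { refl := by rintro (x | x) <;> constructor <;> exact Setoid.refl' _ _
      symm := by rintro _ _ (h | h) <;> constructor <;> exact Setoid.symm' _ h
      trans := by
        rintro _ _ _ (h | h) (h' | h') <;> constructor <;> exact Setoid.trans' _ h h' }

/-- Juxtaposition of two labelled partitions. -/
def Labelled.sum (P : Labelled α) (Q : Labelled β) : Labelled (α ⊕ β) :=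
  ⟨sumPart P.part Q.part, Sum.elim P.label Q.label⟩

/-- Transport of a labelled partition along a bijection. -/
def Labelled.reindex (e : β ≃ α) (P : Labelled α) : Labelled β :=
  ⟨P.part.comap e, P.label ∘ e⟩

/-- The bottom and top rows of a diagram of size `(k + m, l + n)`, cut into a left diagram of size
`(k, l)` and a right diagram of size `(m, n)`. -/
def cut (k l m n : ℕ) :
    Fin (k + m) ⊕ Fin (l + n) ≃ (Fin k ⊕ Fin l) ⊕ (Fin m ⊕ Fin n) :=
  (finSumFinEquiv.symm.sumCongr finSumFinEquiv.symm).trans (Equiv.sumSumSumComm _ _ _ _)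

/-- Horizontal concatenation of equivalence classes of coloured partitions. -/
def Coloured.tensor {k l m n : ℕ} (P : Coloured (Fin k ⊕ Fin l)) (Q : Coloured (Fin m ⊕ Fin n)) :
    Coloured (Fin (k + m) ⊕ Fin (l + n)) :=
  Quotient.map₂ (fun P Q => (P.sum Q).reindex (cut k l m n)) (by
    rintro ⟨p, u⟩ ⟨p', u'⟩ ⟨h1, c, hc, hl⟩ ⟨q, v⟩ ⟨q', v'⟩ ⟨h2, d, hd, hl'⟩
    dsimp at h1 h2 hc hl hd hl'
    subst h1; subst h2
    refine ⟨rfl, Sum.elim c d ∘ cut k l m n, ?_, ?_⟩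
    · intro x y hxy
      have hxy' : Sum.LiftRel p q (cut k l m n x) (cut k l m n y) := hxy
      simp only [Function.comp]
      generalize cut k l m n x = x' at hxy' ⊢
      generalize cut k l m n y = y' at hxy' ⊢
      rcases hxy' with h | h
      · exact hc _ _ h
      · exact hd _ _ h
    · intro x
      simp only [Labelled.reindex, Labelled.sum, Function.comp]
      generalize cut k l m n x = x'
      rcases x' with x' | x'
      · exact hl x'
      · exact hl' x') P Q

end Tensor

/-! ### Linear combinations of diagrams -/

section Linear

variable {α β γ δ : Type}

/-- The linear combination of diagrams given by a product of diagrams, loops being evaluated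
at `t`. -/
def evalLoops (t : ℂ) (o : Option (ℕ × Coloured α)) : Coloured α →₀ ℂ :=
  o.elim 0 (fun A => Finsupp.single A.2 (t ^ A.1))

/-- The composition `(p, q) ↦ t ^ l(q, p) q p` of coloured partitions, extended bilinearly. The
composite of an incompatible pair is `0`. -/
def colComp (t : ℂ) : (Coloured (α ⊕ β) →₀ ℂ) →ₗ[ℂ] (Coloured (β ⊕ γ) →₀ ℂ) →ₗ[ℂ]
    (Coloured (α ⊕ γ) →₀ ℂ) :=
  Finsupp.linearCombination ℂ fun P => Finsupp.linearCombination ℂ fun Q => evalLoops t (P.mul Q)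

/-- Even partitions. -/
abbrev EvenPart (α : Type) : Type := {p : Setoid α // IsEven p}

/-- The composition `(p, q) ↦ t ^ l(q, p) q p` of even partitions, extended bilinearly. -/
def evenComp [Finite α] [Finite β] [Finite γ] (t : ℂ) :
    (EvenPart (α ⊕ β) →₀ ℂ) →ₗ[ℂ] (EvenPart (β ⊕ γ) →₀ ℂ) →ₗ[ℂ] (EvenPart (α ⊕ γ) →₀ ℂ) :=
  Finsupp.linearCombination ℂ fun p => Finsupp.linearCombination ℂ fun q =>
    Finsupp.single ⟨vcomp p.1 q.1, isEven_vcomp p.2 q.2⟩ (t ^ loops p.1 q.1)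

/-- The tensor product of linear combinations of coloured partitions. -/
def colTensor {k l m n : ℕ} : (Coloured (Fin k ⊕ Fin l) →₀ ℂ) →ₗ[ℂ]
    (Coloured (Fin m ⊕ Fin n) →₀ ℂ) →ₗ[ℂ] (Coloured (Fin (k + m) ⊕ Fin (l + n)) →₀ ℂ) :=
  Finsupp.linearCombination ℂ fun P => Finsupp.linearCombination ℂ fun Q =>
    Finsupp.single (P.tensor Q) 1

/-- The diagram of `p` coloured by `u`, as a basis vector. -/
def diag (p : Setoid α) (u : α → ℤˣ) : Coloured α →₀ ℂ := Finsupp.single (colour p u) 1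

theorem colComp_single (t : ℂ) (P : Coloured (α ⊕ β)) (Q : Coloured (β ⊕ γ)) (a b : ℂ) :
    colComp t (Finsupp.single P a) (Finsupp.single Q b) = (a * b) • evalLoops t (P.mul Q) := by
  simp [colComp, mul_smul]

theorem colComp_assoc [Finite α] [Finite β] [Finite γ] [Finite δ] (t : ℂ)
    (f : Coloured (α ⊕ β) →₀ ℂ) (g : Coloured (β ⊕ γ) →₀ ℂ) (h : Coloured (γ ⊕ δ) →₀ ℂ) :
    colComp t (colComp t f g) h = colComp t f (colComp t g h) := by
  induction f using Finsupp.induction_linear with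
  | zero => simp
  | add f f' hf hf' => simp [hf, hf']
  | single P a =>
  induction g using Finsupp.induction_linear with
  | zero => simp
  | add f f' hf hf' => simp [hf, hf']
  | single Q b =>
  induction h using Finsupp.induction_linear with
  | zero => simp
  | add f f' hf hf' => simp [hf, hf']
  | single R c =>
  have key := congrArg (evalLoops t) (mul_assoc_coloured P Q R)
  have hm : ∀ (n : ℕ) (o : Option (ℕ × Coloured (α ⊕ δ))),
      evalLoops t (o.map fun B => (n + B.1, B.2)) = t ^ n • evalLoops t o := by
    rintro n (_ | ⟨m, B⟩)
    · simp [evalLoops]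
    · simp [evalLoops, pow_add]
  have h1 : colComp t (evalLoops t (P.mul Q)) (Finsupp.single R c) =
      c • evalLoops t ((P.mul Q).bind fun A => (A.2.mul R).map fun B => (A.1 + B.1, B.2)) := by
    rcases P.mul Q with _ | ⟨n, A⟩
    · simp [evalLoops]
    · rw [Option.bind_some, hm, smul_smul, mul_comm c]
      exact colComp_single t A R (t ^ n) c
  have h2 : colComp t (Finsupp.single P a) (evalLoops t (Q.mul R)) =
      a • evalLoops t ((Q.mul R).bind fun A => (P.mul A.2).map fun B => (A.1 + B.1, B.2)) := by
    rcases Q.mul R with _ | ⟨n, A⟩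
    · simp [evalLoops]
    · rw [Option.bind_some, hm, smul_smul]
      exact colComp_single t P A a (t ^ n)
  rw [colComp_single, colComp_single, map_smul, map_smul, LinearMap.smul_apply, h1, h2, key,
    smul_smul, smul_smul]
  congr 1
  ring

theorem colComp_id_diag (t : ℂ) (z : α → ℤˣ) (p : Setoid (α ⊕ β)) (u : α ⊕ β → ℤˣ) :
    colComp t (diag (idPart α) (Sum.elim z 1)) (diag p u) = diag p (u * Sum.elim z 1) := by
  rw [diag, diag, colComp_single, id_mul_coloured]
  simp [evalLoops, diag]

theorem colComp_diag_id (t : ℂ) (z : β → ℤˣ) (p : Setoid (α ⊕ β)) (u : α ⊕ β → ℤˣ) :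
    colComp t (diag p u) (diag (idPart β) (Sum.elim z 1)) =
      diag p (u * Sum.elim (1 : α → ℤˣ) z) := by
  rw [diag, diag, colComp_single, mul_id_coloured]
  simp [evalLoops, diag]

theorem elim_one_one : (Sum.elim 1 1 : α ⊕ β → ℤˣ) = 1 := by
  funext x; rcases x with x | x <;> rfl

theorem diag_induction {motive : (Coloured α →₀ ℂ) → Prop} (f : Coloured α →₀ ℂ)
    (zero : motive 0) (add : ∀ f g, motive f → motive g → motive (f + g))
    (smul : ∀ p u (a : ℂ), motive (a • diag p u)) : motive f := by
  induction f using Finsupp.induction_linear with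
  | zero => exact zero
  | add f f' hf hf' => exact add _ _ hf hf'
  | single P a =>
    induction P using Coloured.ind with | h p u =>
    have := smul p u a
    rwa [diag, Finsupp.smul_single, smul_eq_mul, mul_one] at this

theorem colComp_id_left (t : ℂ) (f : Coloured (α ⊕ β) →₀ ℂ) :
    colComp t (diag (idPart α) 1) f = f := by
  induction f using diag_induction with
  | zero => simp
  | add f g hf hg => simp [hf, hg]
  | smul p u a =>
    have h := colComp_id_diag t 1 p u
    rw [elim_one_one, elim_one_one, mul_one] at h
    rw [map_smul, h]

theorem colComp_id_right (t : ℂ) (f : Coloured (α ⊕ β) →₀ ℂ) :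
    colComp t f (diag (idPart β) 1) = f := by
  induction f using diag_induction with
  | zero => simp
  | add f g hf hg => simp [hf, hg]
  | smul p u a =>
    have h := colComp_diag_id t 1 p u
    rw [elim_one_one, elim_one_one, mul_one] at h
    rw [map_smul, LinearMap.smul_apply, h]

theorem evenComp_single [Finite α] [Finite β] [Finite γ] (t : ℂ) (p : EvenPart (α ⊕ β))
    (q : EvenPart (β ⊕ γ)) (a b : ℂ) :
    evenComp t (Finsupp.single p a) (Finsupp.single q b) =
      Finsupp.single ⟨vcomp p.1 q.1, isEven_vcomp p.2 q.2⟩ (a * b * t ^ loops p.1 q.1) := by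
  rw [evenComp, Finsupp.linearCombination_single, LinearMap.smul_apply,
    Finsupp.linearCombination_single, Finsupp.smul_single, Finsupp.smul_single, smul_eq_mul,
    smul_eq_mul, mul_assoc]

theorem evenComp_assoc [Finite α] [Finite β] [Finite γ] [Finite δ] (t : ℂ)
    (f : EvenPart (α ⊕ β) →₀ ℂ) (g : EvenPart (β ⊕ γ) →₀ ℂ) (h : EvenPart (γ ⊕ δ) →₀ ℂ) :
    evenComp t (evenComp t f g) h = evenComp t f (evenComp t g h) := by
  induction f using Finsupp.induction_linear with
  | zero => simp
  | add f f' hf hf' => simp [hf, hf']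
  | single P a =>
  induction g using Finsupp.induction_linear with
  | zero => simp
  | add f f' hf hf' => simp [hf, hf']
  | single Q b =>
  induction h using Finsupp.induction_linear with
  | zero => simp
  | add f f' hf hf' => simp [hf, hf']
  | single R c =>
  obtain ⟨h1, h2⟩ := vcomp_assoc P.1 Q.1 R.1
  simp only [evenComp_single]
  congr 1
  · exact Subtype.ext h2
  · calc _ = a * b * c * t ^ (loops P.1 Q.1 + loops (vcomp P.1 Q.1) R.1) := by
          rw [pow_add]; ring
      _ = _ := by rw [h1, pow_add]; ring

theorem evenComp_id_left [Finite α] [Finite β] (t : ℂ) (f : EvenPart (α ⊕ β) →₀ ℂ) :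
    evenComp t (Finsupp.single ⟨idPart α, isEven_idPart⟩ 1) f = f := by
  induction f using Finsupp.induction_linear with
  | zero => simp
  | add f f' hf hf' => simp [hf, hf']
  | single P a =>
    rw [evenComp_single]
    congr 1
    · exact Subtype.ext (vcomp_idPart_left _)
    · simp [loops_idPart_left]

theorem evenComp_id_right [Finite α] [Finite β] (t : ℂ) (f : EvenPart (α ⊕ β) →₀ ℂ) :
    evenComp t f (Finsupp.single ⟨idPart β, isEven_idPart⟩ 1) = f := by
  induction f using Finsupp.induction_linear with
  | zero => simp
  | add f f' hf hf' => simp [hf, hf']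
  | single P a =>
    rw [evenComp_single]
    congr 1
    · exact Subtype.ext (vcomp_idPart_right _)
    · simp [loops_idPart_right]

end Linear

/-! ### The categories -/

/-- The objects `[ñ]`, `n ∈ ℕ`, of the category `Par(ℤ₂, t)`. -/
@[ext] structure ParZ2 (t : ℂ) where
  rank : ℕ

/-- The category `Par(ℤ₂, t)`: morphisms are linear combinations of equivalence classes of
`ℤ₂`-coloured partitions. -/
instance (t : ℂ) : Category (ParZ2 t) where
  Hom X Y := Coloured (Fin X.rank ⊕ Fin Y.rank) →₀ ℂ
  id X := diag (idPart (Fin X.rank)) 1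
  comp f g := colComp t f g
  id_comp := colComp_id_left t
  comp_id := colComp_id_right t
  assoc := colComp_assoc t

instance (t : ℂ) : Preadditive (ParZ2 t) where
  homGroup X Y := inferInstanceAs (AddCommGroup (Coloured (Fin X.rank ⊕ Fin Y.rank) →₀ ℂ))
  add_comp _ _ _ f f' g := DFunLike.congr_fun ((colComp t).map_add f f') g
  comp_add _ _ _ f g g' := (colComp t f).map_add g g'

instance (t : ℂ) : Linear ℂ (ParZ2 t) where
  homModule X Y := inferInstanceAs (Module ℂ (Coloured (Fin X.rank ⊕ Fin Y.rank) →₀ ℂ))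
  smul_comp _ _ _ r f g := DFunLike.congr_fun ((colComp t).map_smul r f) g
  comp_smul _ _ _ f r g := (colComp t f).map_smul r g

/-- The objects `[n]`, `n ∈ ℕ`, of the category `Rep₀(H_t)`. -/
@[ext] structure RepH0 (t : ℂ) where
  rank : ℕ

/-- The category `Rep₀(H_t)`: morphisms are linear combinations of even partitions. -/
instance (t : ℂ) : Category (RepH0 t) where
  Hom X Y := EvenPart (Fin X.rank ⊕ Fin Y.rank) →₀ ℂ
  id X := Finsupp.single ⟨idPart (Fin X.rank), isEven_idPart⟩ 1
  comp f g := evenComp t f g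
  id_comp := evenComp_id_left t
  comp_id := evenComp_id_right t
  assoc := evenComp_assoc t

instance (t : ℂ) : Preadditive (RepH0 t) where
  homGroup X Y := inferInstanceAs (AddCommGroup (EvenPart (Fin X.rank ⊕ Fin Y.rank) →₀ ℂ))
  add_comp _ _ _ f f' g := DFunLike.congr_fun ((evenComp t).map_add f f') g
  comp_add _ _ _ f g g' := (evenComp t f).map_add g g'

instance (t : ℂ) : Linear ℂ (RepH0 t) where
  homModule X Y := inferInstanceAs (Module ℂ (EvenPart (Fin X.rank ⊕ Fin Y.rank) →₀ ℂ))
  smul_comp _ _ _ r f g := DFunLike.congr_fun ((evenComp t).map_smul r f) g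
  comp_smul _ _ _ f r g := (evenComp t f).map_smul r g

/-- The Karoubian envelope `Par(ℤ₂, t)^Kar`: the idempotent completion of the additive envelope. -/
abbrev ParZ2Kar (t : ℂ) : Type 1 := Idempotents.Karoubi (Mat_ (ParZ2 t))

/-! ### The functor `Ω₀` -/

/-- `e' = (1 - τ) / 2`, where `τ` is the strand with one endpoint labelled by `-1`. -/
def ePrime : Coloured (Fin 1 ⊕ Fin 1) →₀ ℂ :=
  (1 / 2 : ℂ) • (diag (idPart (Fin 1)) 1 - diag (idPart (Fin 1)) (Sum.elim (fun _ => -1) 1))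

/-- `e'^{⊗ n}`. -/
def ePrimePow : (n : ℕ) → (Coloured (Fin n ⊕ Fin n) →₀ ℂ)
  | 0 => diag (idPart (Fin 0)) 1
  | n + 1 => colTensor (ePrimePow n) ePrime

/-- The normalisation `2 ^ (((∑ᵢ mᵢ) - 2 s) / 2)` for a partition with `s` blocks of sizes
`m₁, …, m_s`. -/
def weight {α : Type} (p : Setoid α) : ℂ :=
  (2 : ℂ) ^ ((((∑ᶠ c : Quotient p, Nat.card {x : α // Quotient.mk p x = c} : ℕ) : ℤ)
    - 2 * (numBlocks p : ℤ)) / 2)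

/-- `f ↦ 2 ^ (((∑ᵢ mᵢ) - 2 s) / 2) e'^{⊗ l} ∘ f ∘ e'^{⊗ k}`, with values in `Par(ℤ₂, 2t)`,
extended linearly from even partitions. -/
def omegaHom (t : ℂ) (k l : ℕ) :
    (EvenPart (Fin k ⊕ Fin l) →₀ ℂ) →ₗ[ℂ] (Coloured (Fin k ⊕ Fin l) →₀ ℂ) :=
  Finsupp.linearCombination ℂ fun f =>
    weight f.1 • colComp (2 * t) (colComp (2 * t) (ePrimePow k) (diag f.1 1)) (ePrimePow l)

/-! Facts making `Ω₀` well defined -/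

section Facts

variable {α β γ : Type}

/-- The product of all signs, as a complex number. -/
def sg [Fintype α] (f : α → ℤˣ) : ℂ := (((∏ x, f x : ℤˣ) : ℤ) : ℂ)

theorem sg_mul [Fintype α] (f g : α → ℤˣ) : sg (f * g) = sg f * sg g := by
  simp [sg, Finset.prod_mul_distrib]

theorem sg_mul_self [Fintype α] (f : α → ℤˣ) : sg f * sg f = 1 := by
  rw [← sg_mul]
  have : f * f = 1 := by funext i; simp
  rw [this]; simp [sg]

theorem idPart_apply (x y : α ⊕ α) :
    idPart α x y ↔ Sum.elim id id x = Sum.elim id id y := Iff.rfl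

theorem tensor_id (n : ℕ) (z : Fin n → ℤˣ) (s : ℤˣ) :
    (colour (idPart (Fin n)) (Sum.elim z 1)).tensor
      (colour (idPart (Fin 1)) (Sum.elim (fun _ => s) 1)) =
    colour (idPart (Fin (n + 1))) (Sum.elim (Fin.snoc z s : Fin (n + 1) → ℤˣ) 1) := by
  have hl : ∀ i : Fin n, ((cut n n 1 1) (Sum.inl i.castSucc)) = Sum.inl (Sum.inl i) := fun i => by
    have : i.castSucc = Fin.castAdd 1 i := rfl
    rw [this]; simp [cut]
  have hl' : ((cut n n 1 1) (Sum.inl (Fin.last n))) = Sum.inr (Sum.inl 0) := by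
    have : Fin.last n = Fin.natAdd n (0 : Fin 1) := rfl
    rw [this]; simp [cut]
  have hr : ∀ i : Fin n, ((cut n n 1 1) (Sum.inr i.castSucc)) = Sum.inl (Sum.inr i) := fun i => by
    have : i.castSucc = Fin.castAdd 1 i := rfl
    rw [this]; simp [cut]
  have hr' : ((cut n n 1 1) (Sum.inr (Fin.last n))) = Sum.inr (Sum.inr 0) := by
    have : Fin.last n = Fin.natAdd n (0 : Fin 1) := rfl
    rw [this]; simp [cut]
  refine congrArg (Quotient.mk _) (Labelled.ext ?_ ?_)
  · ext x y
    show Sum.LiftRel (idPart (Fin n)) (idPart (Fin 1)) (cut n n 1 1 x) (cut n n 1 1 y) ↔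
      Sum.elim id id x = Sum.elim id id y
    rcases x with x | x <;> rcases y with y | y <;>
    refine Fin.lastCases ?_ (fun x => ?_) x <;>
    refine Fin.lastCases ?_ (fun y => ?_) y <;>
    simp [hl, hl', hr, hr', idPart_apply, Fin.castSucc_ne_last,
      (Fin.castSucc_ne_last _).symm]
  · funext x
    show Sum.elim _ _ (cut n n 1 1 x) = _
    rcases x with x | x <;>
    refine Fin.lastCases ?_ (fun x => ?_) x <;>
    simp [hl, hl', hr, hr']

theorem ePrime_eq : ePrime = (1 / 2 : ℂ) • ∑ s : ℤˣ, ((s : ℤ) : ℂ) •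
    diag (idPart (Fin 1)) (Sum.elim (fun _ => s) 1) := by
  have : (Finset.univ : Finset ℤˣ) = {1, -1} := rfl
  rw [this, Finset.sum_pair (by decide), ePrime]
  have h : (Sum.elim (fun _ => 1) 1 : Fin 1 ⊕ Fin 1 → ℤˣ) = 1 := elim_one_one
  rw [h]
  simp [sub_eq_add_neg]

theorem ePrimePow_eq (n : ℕ) : ePrimePow n = (1 / 2 : ℂ) ^ n • ∑ z : Fin n → ℤˣ,
    sg z • diag (idPart (Fin n)) (Sum.elim z 1) := by
  induction n with
  | zero =>
    rw [ePrimePow, Fintype.sum_unique]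
    have : ∀ u : Fin 0 ⊕ Fin 0 → ℤˣ, u = 1 := fun u => by
      funext x; rcases x with x | x <;> exact x.elim0
    rw [this (Sum.elim _ _)]
    simp [sg]
  | succ n ih =>
    rw [ePrimePow, ih, ePrime_eq, ← (Fin.snocEquiv (fun _ : Fin (n + 1) => ℤˣ)).sum_comp,
      Fintype.sum_prod_type]
    simp only [map_smul, LinearMap.smul_apply, map_sum, LinearMap.sum_apply, smul_smul,
      Finset.smul_sum]
    refine Finset.sum_congr rfl fun s _ => Finset.sum_congr rfl fun z _ => ?_
    have h1 : colTensor (diag (idPart (Fin n)) (Sum.elim z 1))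
        (diag (idPart (Fin 1)) (Sum.elim (fun _ => s) 1)) =
        diag (idPart (Fin (n + 1))) (Sum.elim (Fin.snoc z s : Fin (n + 1) → ℤˣ) 1) := by
      simp [colTensor, diag, tensor_id]
    have h2 : sg (Fin.snoc z s : Fin (n + 1) → ℤˣ) = sg z * ((s : ℤ) : ℂ) := by
      simp [sg, Fin.prod_univ_castSucc]
    have h3 : (Fin.snocEquiv (fun _ : Fin (n + 1) => ℤˣ)) (s, z) = Fin.snoc z s := rfl
    rw [h1, h3, h2]
    congr 1
    ring

theorem sum_shift [Fintype α] [DecidableEq α] {M : Type} [AddCommGroup M] [Module ℂ M] (c : α → ℤˣ)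
    (F : (α → ℤˣ) → M) : ∑ z, sg z • F (c * z) = sg c • ∑ z, sg z • F z := by
  rw [← Equiv.sum_comp (Equiv.mulLeft c) (fun z => sg z • F z), Finset.smul_sum]
  refine Finset.sum_congr rfl fun z _ => ?_
  rw [Equiv.coe_mulLeft, sg_mul, smul_smul, ← mul_assoc, sg_mul_self, one_mul]

theorem ePow_comp_diag (t : ℂ) (k : ℕ) (p : Setoid (Fin k ⊕ β)) (u : Fin k ⊕ β → ℤˣ) :
    colComp t (ePrimePow k) (diag p u) =
      (1 / 2 : ℂ) ^ k • ∑ z : Fin k → ℤˣ, sg z • diag p (u * Sum.elim z 1) := by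
  rw [ePrimePow_eq]
  simp only [map_smul, LinearMap.smul_apply, map_sum, LinearMap.sum_apply, colComp_id_diag]

theorem diag_comp_ePow (t : ℂ) (k : ℕ) (p : Setoid (α ⊕ Fin k)) (u : α ⊕ Fin k → ℤˣ) :
    colComp t (diag p u) (ePrimePow k) =
      (1 / 2 : ℂ) ^ k • ∑ z : Fin k → ℤˣ, sg z • diag p (u * Sum.elim (1 : α → ℤˣ) z) := by
  rw [ePrimePow_eq]
  simp only [map_smul, map_sum, colComp_diag_id]

theorem ePow_absorb (t : ℂ) (k : ℕ) (p : Setoid (Fin k ⊕ β)) (u : Fin k ⊕ β → ℤˣ)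
    (c : Fin k → ℤˣ) : colComp t (ePrimePow k) (diag p (u * Sum.elim c 1)) =
      sg c • colComp t (ePrimePow k) (diag p u) := by
  rw [ePow_comp_diag, ePow_comp_diag, smul_comm, ← sum_shift]
  congr 1
  refine Finset.sum_congr rfl fun z _ => ?_
  congr 2
  rw [mul_assoc]
  congr 1
  funext x; rcases x with x | x <;> simp

theorem absorb_ePow (t : ℂ) (k : ℕ) (p : Setoid (α ⊕ Fin k)) (u : α ⊕ Fin k → ℤˣ)
    (c : Fin k → ℤˣ) : colComp t (diag p (u * Sum.elim (1 : α → ℤˣ) c)) (ePrimePow k) =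
      sg c • colComp t (diag p u) (ePrimePow k) := by
  rw [diag_comp_ePow, diag_comp_ePow, smul_comm, ← sum_shift]
  congr 1
  refine Finset.sum_congr rfl fun z _ => ?_
  congr 2
  rw [mul_assoc]
  congr 1
  funext x; rcases x with x | x <;> simp

theorem ePrimePow_idem (t : ℂ) (k : ℕ) :
    colComp t (ePrimePow k) (ePrimePow k) = ePrimePow k := by
  conv_lhs => arg 2; rw [ePrimePow_eq]
  have h : ∀ z : Fin k → ℤˣ, colComp t (ePrimePow k)
      (diag (idPart (Fin k)) (Sum.elim z 1)) = sg z • ePrimePow k := fun z => by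
    have := ePow_absorb t k (idPart (Fin k)) 1 z
    rwa [one_mul, colComp_id_right] at this
  simp only [map_smul, map_sum, h, smul_smul, sg_mul_self, one_smul, Finset.sum_const,
    Finset.card_univ]
  rw [← Nat.cast_smul_eq_nsmul ℂ, smul_smul]
  simp

theorem sandwich_absorb (t : ℂ) (k l : ℕ) (p : Setoid (Fin k ⊕ Fin l)) (u : Fin k ⊕ Fin l → ℤˣ) :
    colComp t (colComp t (ePrimePow k) (diag p u)) (ePrimePow l) =
      sg u • colComp t (colComp t (ePrimePow k) (diag p 1)) (ePrimePow l) := by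
  have hu : u = 1 * Sum.elim (1 : Fin k → ℤˣ) (u ∘ Sum.inr) * Sum.elim (u ∘ Sum.inl) 1 := by
    funext x; rcases x with x | x <;> simp
  have hs : sg u = sg (u ∘ Sum.inl) * sg (u ∘ Sum.inr) := by
    simp [sg, Fintype.prod_sum_type]
  conv_lhs => rw [hu]
  rw [ePow_absorb, map_smul, LinearMap.smul_apply, colComp_assoc, absorb_ePow, map_smul,
    ← colComp_assoc, smul_smul, hs]

theorem sg_of_isEven [Fintype α] {p : Setoid α} (hp : IsEven p) {f : α → ℤˣ} (hf : f ∈ signs p) :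
    sg f = 1 := by
  rw [sg, (isEven_iff p).1 hp f hf]; simp

/-- Composition through the idempotent in the middle. -/
theorem sandwich_mul (t : ℂ) (k l m : ℕ) {p : Setoid (Fin k ⊕ Fin l)} {q : Setoid (Fin l ⊕ Fin m)}
    (hp : IsEven p) (hq : IsEven q) :
    colComp t (colComp t (ePrimePow k) (colComp t (diag p 1)
      (colComp t (ePrimePow l) (diag q 1)))) (ePrimePow m) =
    ((1 / 2 : ℂ) ^ l * (Nat.card (midHom p q).range : ℂ) * t ^ loops p q) •
      colComp t (colComp t (ePrimePow k) (diag (vcomp p q) 1)) (ePrimePow m) := by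
  classical
  rw [ePow_comp_diag]
  simp only [map_smul, map_sum, LinearMap.smul_apply, LinearMap.sum_apply, one_mul]
  rw [mul_assoc, mul_smul]
  congr 1
  have key : ∀ y : Fin l → ℤˣ,
      sg y • colComp t (colComp t (ePrimePow k) (colComp t (diag p 1) (diag q (Sum.elim y 1))))
        (ePrimePow m) =
      if y ∈ (midHom p q).range then
        t ^ loops p q • colComp t (colComp t (ePrimePow k) (diag (vcomp p q) 1)) (ePrimePow m)
      else 0 := by
    intro y
    rw [diag, diag, colComp_single, one_mul, one_smul]
    split_ifs with hy
    · obtain ⟨⟨⟨a, ha⟩, ⟨b, hb⟩⟩, rfl⟩ := hy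
      set y := midHom p q (⟨a, ha⟩, ⟨b, hb⟩) with hydef
      have hy : ∀ i, y i = a (Sum.inr i) * b (Sum.inl i) := fun i => rfl
      have h := mul_eq_of_sol (P := colour p 1) (Q := colour q (Sum.elim y 1))
        (w := Sum.elim (fun i => a (Sum.inl i)) (Sum.elim (fun i => a (Sum.inr i))
          (fun i => b (Sum.inr i))))
        (by
          rw [mem_sol, one_mul]
          convert ha using 1
          funext x; rcases x with x | x <;> rfl)
        (by
          rw [mem_sol]
          convert hb using 1
          funext x; rcases x with x | x
          · simp only [hi, hy, Pi.mul_apply, Function.comp, Sum.elim_inl, Sum.elim_inr]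
            rw [mul_right_comm, Int.units_mul_self, one_mul]
          · simp [hi])
      rw [h]
      have h2 : evalLoops t (some (loops (colour p 1).part (colour q (Sum.elim y 1)).part,
          colour (vcomp (colour p 1).part (colour q (Sum.elim y 1)).part)
          ((Sum.elim (fun i => a (Sum.inl i)) (Sum.elim (fun i => a (Sum.inr i))
          (fun i => b (Sum.inr i)))) ∘ outer))) =
          t ^ loops p q • diag (vcomp p q)
            (Sum.elim (fun i => a (Sum.inl i)) (fun i => b (Sum.inr i))) := by
        have : ((Sum.elim (fun i => a (Sum.inl i)) (Sum.elim (fun i => a (Sum.inr i))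
          (fun i => b (Sum.inr i)))) ∘ outer) =
            Sum.elim (fun i => a (Sum.inl i)) (fun i => b (Sum.inr i)) := by
          funext x; rcases x with x | x <;> rfl
        rw [this]
        simp [evalLoops, diag]
      rw [h2, map_smul, map_smul, LinearMap.smul_apply, sandwich_absorb, smul_smul, smul_smul]
      congr 1
      have e1 := sg_of_isEven hp ha
      have e2 := sg_of_isEven hq hb
      have e3 : sg y * sg (Sum.elim (fun i => a (Sum.inl i)) (fun i => b (Sum.inr i)) :
          Fin k ⊕ Fin m → ℤˣ) = sg a * sg b := by
        simp only [sg, Fintype.prod_sum_type, hy, Finset.prod_mul_distrib, Sum.elim_inl,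
          Sum.elim_inr]
        push_cast
        ring
      rw [e1, e2, one_mul] at e3
      rw [mul_right_comm, e3, one_mul]
    · by_cases hn : (colour p 1).mul (colour q (Sum.elim y 1)) = none
      · rw [hn]; simp [evalLoops]
      · exfalso
        obtain ⟨w, h1, h2⟩ := exists_sol_of_mul hn
        rw [mem_sol] at h1 h2
        refine hy ⟨(⟨_, h1⟩, ⟨_, h2⟩), ?_⟩
        funext i
        simp [midHom, lo, hi, mul_left_comm]
  rw [Finset.sum_congr rfl (fun y _ => key y), ← Finset.sum_filter, Finset.sum_const,
    ← Nat.cast_smul_eq_nsmul ℂ, smul_smul, Nat.card_eq_fintype_card]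
  congr 3
  rw [Fintype.card_subtype]

theorem sum_blocks [Finite α] (p : Setoid α) :
    ∑ᶠ c : Quotient p, Nat.card {x : α // Quotient.mk p x = c} = Nat.card α := by
  have := Fintype.ofFinite α
  have := Fintype.ofFinite (Quotient p)
  rw [finsum_eq_sum_of_fintype, ← Nat.card_sigma]
  exact Nat.card_congr (Equiv.sigmaFiberEquiv _)

theorem even_card_of_isEven [Finite α] {p : Setoid α} (hp : IsEven p) : Even (Nat.card α) := by
  have := Fintype.ofFinite (Quotient p)
  rw [← sum_blocks p, finsum_eq_sum_of_fintype]
  exact Finset.even_sum _ fun c _ => hp c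

theorem weight_mul (t : ℂ) {k l m : ℕ} {p : Setoid (Fin k ⊕ Fin l)} {q : Setoid (Fin l ⊕ Fin m)}
    (hp : IsEven p) (hq : IsEven q) :
    weight p * weight q * ((1 / 2 : ℂ) ^ l * (Nat.card (midHom p q).range : ℂ) *
      (2 * t) ^ loops p q) = t ^ loops p q * weight (vcomp p q) := by
  obtain ⟨a, ha⟩ := even_card_of_isEven hp
  obtain ⟨b, hb⟩ := even_card_of_isEven hq
  have hN := card_midHom_range p q
  rw [weight, weight, weight, sum_blocks, sum_blocks, sum_blocks]
  rw [Nat.card_sum, Nat.card_fin, Nat.card_fin] at ha hb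
  simp only [Nat.card_sum, Nat.card_fin]
  have e1 : (((k + l : ℕ) : ℤ) - 2 * (numBlocks p : ℤ)) / 2 = (a : ℤ) - numBlocks p := by omega
  have e2 : (((l + m : ℕ) : ℤ) - 2 * (numBlocks q : ℤ)) / 2 = (b : ℤ) - numBlocks q := by omega
  have e3 : (((k + m : ℕ) : ℤ) - 2 * (numBlocks (vcomp p q) : ℤ)) / 2 =
      (a : ℤ) + b - l - numBlocks (vcomp p q) := by omega
  rw [e1, e2, e3]
  have h2 : (2 : ℂ) ≠ 0 := two_ne_zero
  have hN' : (Nat.card (midHom p q).range : ℂ) = (2 : ℂ) ^ ((numBlocks p : ℤ) + numBlocks q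
      - (numBlocks (vcomp p q) + loops p q)) := by
    rw [zpow_sub₀ h2, eq_div_iff (zpow_ne_zero _ h2)]
    have := congrArg (Nat.cast : ℕ → ℂ) hN
    push_cast at this
    exact_mod_cast this.symm
  rw [hN', mul_pow, one_div, inv_pow, ← zpow_natCast (2 : ℂ) l, ← zpow_neg,
    ← zpow_natCast (2 : ℂ) (loops p q)]
  have e4 : (a : ℤ) + b - l - numBlocks (vcomp p q) = ((a : ℤ) - numBlocks p) +
      ((b : ℤ) - numBlocks q) + (-(l : ℤ)) + ((numBlocks p : ℤ) + numBlocks q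
      - (numBlocks (vcomp p q) + loops p q)) + loops p q := by ring
  rw [e4, zpow_add₀ h2, zpow_add₀ h2, zpow_add₀ h2, zpow_add₀ h2]
  ring

theorem weight_idPart (k : ℕ) : weight (idPart (Fin k)) = 1 := by
  have h : numBlocks (idPart (Fin k)) = k := by
    rw [numBlocks, idPart, Nat.card_congr (Setoid.quotientKerEquivOfSurjective _
      (fun x => ⟨Sum.inl x, rfl⟩)), Nat.card_fin]
  rw [weight, sum_blocks, h, Nat.card_sum, Nat.card_fin]
  have : ((((k + k : ℕ) : ℤ) - 2 * (k : ℤ)) / 2) = 0 := by omega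
  rw [this, zpow_zero]

theorem omegaHom_comm (t : ℂ) (k l : ℕ) (f : EvenPart (Fin k ⊕ Fin l) →₀ ℂ) :
    colComp (2 * t) (ePrimePow k) (colComp (2 * t) (omegaHom t k l f) (ePrimePow l)) =
      omegaHom t k l f := by
  induction f using Finsupp.induction_linear with
  | zero => simp
  | add f f' hf hf' => simp [hf, hf']
  | single P a =>
    simp only [omegaHom, Finsupp.linearCombination_single, map_smul, LinearMap.smul_apply]
    rw [colComp_assoc (2 * t) _ (ePrimePow l) (ePrimePow l), ePrimePow_idem, ← colComp_assoc,
      ← colComp_assoc, ePrimePow_idem]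

theorem omegaHom_id (t : ℂ) (k : ℕ) :
    omegaHom t k k (Finsupp.single ⟨idPart (Fin k), isEven_idPart⟩ 1) = ePrimePow k := by
  simp only [omegaHom, Finsupp.linearCombination_single, weight_idPart, one_smul]
  rw [colComp_id_right, ePrimePow_idem]

theorem omegaHom_comp (t : ℂ) (k l m : ℕ) (f : EvenPart (Fin k ⊕ Fin l) →₀ ℂ)
    (g : EvenPart (Fin l ⊕ Fin m) →₀ ℂ) :
    omegaHom t k m (evenComp t f g) =
      colComp (2 * t) (omegaHom t k l f) (omegaHom t l m g) := by
  induction f using Finsupp.induction_linear with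
  | zero => simp
  | add f f' hf hf' => simp [hf, hf']
  | single p a =>
  induction g using Finsupp.induction_linear with
  | zero => simp
  | add f f' hf hf' => simp [hf, hf']
  | single q b =>
  rw [evenComp_single]
  simp only [omegaHom, Finsupp.linearCombination_single, map_smul, LinearMap.smul_apply]
  have h : colComp (2 * t) (colComp (2 * t) (colComp (2 * t) (ePrimePow k) (diag p.1 1))
      (ePrimePow l)) (colComp (2 * t) (colComp (2 * t) (ePrimePow l) (diag q.1 1))
      (ePrimePow m)) = colComp (2 * t) (colComp (2 * t) (ePrimePow k) (colComp (2 * t) (diag p.1 1)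
      (colComp (2 * t) (ePrimePow l) (diag q.1 1)))) (ePrimePow m) := by
    simp only [colComp_assoc]
    rw [← colComp_assoc (2 * t) (ePrimePow l) (ePrimePow l), ePrimePow_idem]
  rw [h, sandwich_mul _ _ _ _ p.2 q.2]
  simp only [smul_smul]
  congr 1
  have := weight_mul t p.2 q.2
  linear_combination (-(a * b)) * this

end Facts

/-- The object `[ñ]` of `Par(ℤ₂, t)` in the additive envelope. -/
abbrev addObj (t : ℂ) (n : ℕ) : Mat_ (ParZ2 t) := (Mat_.embedding (ParZ2 t)).obj ⟨n⟩

/-- A morphism `[k̃] ⟶ [l̃]` of `Par(ℤ₂, t)` in the additive envelope. -/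
def addHom (t : ℂ) {k l : ℕ} (f : Coloured (Fin k ⊕ Fin l) →₀ ℂ) : addObj t k ⟶ addObj t l :=
  (Mat_.embedding (ParZ2 t)).map (X := ⟨k⟩) (Y := ⟨l⟩) f

theorem addHom_comp (t : ℂ) {k l m : ℕ} (f : Coloured (Fin k ⊕ Fin l) →₀ ℂ)
    (g : Coloured (Fin l ⊕ Fin m) →₀ ℂ) :
    addHom t f ≫ addHom t g = addHom t (colComp t f g) :=
  ((Mat_.embedding (ParZ2 t)).map_comp (X := ⟨k⟩) (Y := ⟨l⟩) (Z := ⟨m⟩) f g).symm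

theorem addHom_comm (t : ℂ) (k l : ℕ) (f : EvenPart (Fin k ⊕ Fin l) →₀ ℂ) :
    addHom (2 * t) (ePrimePow k) ≫ addHom (2 * t) (omegaHom t k l f) ≫
      addHom (2 * t) (ePrimePow l) = addHom (2 * t) (omegaHom t k l f) := by
  rw [addHom_comp, addHom_comp, omegaHom_comm]

/-- The functor `Ω₀ : Rep₀(H_t) ⥤ Par(ℤ₂, 2t)^Kar`, given by `[k] ↦ ([k̃], e'^{⊗ k})` on objects and
by `omegaHom` on morphisms. -/
def Omega0 (t : ℂ) : RepH0 t ⥤ ParZ2Kar (2 * t) where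
  obj X :=
    { X := addObj (2 * t) X.rank
      p := addHom (2 * t) (ePrimePow X.rank)
      idem := by rw [addHom_comp, ePrimePow_idem] }
  map {X Y} f :=
    { f := addHom (2 * t) (omegaHom t X.rank Y.rank f)
      comm := addHom_comm t X.rank Y.rank f }
  map_id X := Idempotents.Karoubi.hom_ext _ _ (congrArg (addHom (2 * t)) (omegaHom_id t X.rank))
  map_comp {X Y Z} f g := Idempotents.Karoubi.hom_ext _ _
    ((congrArg (addHom (2 * t)) (omegaHom_comp t X.rank Y.rank Z.rank f g)).trans
      (addHom_comp (2 * t) _ _).symm)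

end HypOct

end

namespace HypOct

section

variable {α : Type}

/-! The element `e'` is the projection onto the sign character of `ℤ₂`, acting on a strand by
changing one label. Composing a diagram on `k` bottom and `l` top points with the powers of `e'` on
both sides, called sandwiching below, therefore antisymmetrises it under the group `ℤ₂^(k+l)` that
acts by changing labels. By `sandwich_eq`, the sandwich of a partition `p` is the average of `sg u`
times `p` coloured by `u`, over all labellings `u`. Only coloured strands are stacked, so no loop
arises and the underlying partition stays the same. For this reason the loop parameter plays no part
and the argument is uniform in `t`.

The stabiliser of a coloured class with underlying partition `p` is the group `signs p` of sign
functions that are constant on blocks. The antisymmetrisation survives exactly when `sg` is trivial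
on this stabiliser, and this means that all blocks of `p` are even. If `p` has an odd block, the
sandwich equals its own negative (`sandwich_eq_zero`). If `p` is even, its coefficient at the class
with all labels `1` is `2^(-(k+l))` times the order of `signs p`, hence nonzero
(`sandwich_apply_self_ne_zero`).

Faithfulness: sandwiches of distinct partitions have disjoint supports, so the coefficients at the
trivially coloured even classes form a diagonal matrix with nonzero entries (`omegaHom_apply`).
Fullness: a morphism of the Karoubi envelope between the objects in question is a morphism equal to
its own sandwich. Every coloured diagram has, up to sign, the same sandwich as its uncoloured
partition, so sandwiches are spanned by those of even partitions (`sandwich_mem_range_omegaHom`).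
The powers of `2` in the functor matter here only through being invertible. -/

theorem weight_ne_zero (p : Setoid α) : weight p ≠ 0 :=
  zpow_ne_zero _ two_ne_zero

/-! ### Coefficients of antisymmetrised diagrams -/

theorem diag_apply_of_ne {p q : Setoid α} (h : p ≠ q) (u v : α → ℤˣ) :
    diag p u (colour q v) = 0 :=
  Finsupp.single_eq_of_ne fun e => h (congrArg Coloured.part e).symm

-- Changing signs block by block does not alter a coloured class, and these are the only changes
-- allowed; hence the labellings of the trivial class are exactly the elements of `signs p`.
open Classical in
theorem diag_apply_one (p : Setoid α) (u : α → ℤˣ) :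
    diag p u (colour p 1) = if u ∈ signs p then 1 else 0 := by
  rw [diag, Finsupp.single_apply]
  simp only [colour_eq, one_mul]

/-- Expanding both idempotents over labellings of their strands, each strand only multiplies the
label at its end. The pairs `(z, w)` thus run over all labellings of the outer points, and the signs
combine to `sg`. No power of `t` appears, since stacking strands closes no loop. -/
theorem sandwich_eq (t : ℂ) (k l : ℕ) (p : Setoid (Fin k ⊕ Fin l)) :
    colComp t (colComp t (ePrimePow k) (diag p 1)) (ePrimePow l) =
      (1 / 2 : ℂ) ^ (k + l) • ∑ z : Fin k → ℤˣ, ∑ w : Fin l → ℤˣ,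
        sg (Sum.elim z w : Fin k ⊕ Fin l → ℤˣ) • diag p (Sum.elim z w) := by
  rw [ePow_comp_diag]
  simp only [map_smul, map_sum, LinearMap.smul_apply, LinearMap.sum_apply, diag_comp_ePow,
    pow_add, Finset.smul_sum, smul_smul]
  refine Finset.sum_congr rfl fun z _ => Finset.sum_congr rfl fun w _ => ?_
  have hu : (1 : Fin k ⊕ Fin l → ℤˣ) * Sum.elim z 1 * Sum.elim (1 : Fin k → ℤˣ) w =
      Sum.elim z w := by
    funext x; rcases x with x | x <;> simp
  have hs : sg (Sum.elim z w : Fin k ⊕ Fin l → ℤˣ) = sg z * sg w := by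
    simp [sg, Fintype.prod_sum_type]
  rw [hu, hs]
  congr 1
  ring

/-- Every term of `sandwich_eq` is a colouring of `p` itself, so sandwiches of different partitions
have disjoint supports. -/
theorem sandwich_apply_of_ne (t : ℂ) (k l : ℕ) {p q : Setoid (Fin k ⊕ Fin l)} (h : p ≠ q) :
    colComp t (colComp t (ePrimePow k) (diag p 1)) (ePrimePow l) (colour q 1) = 0 := by
  rw [sandwich_eq]
  simp [diag_apply_of_ne h]

/-- The terms that meet the trivial class are those labelled by an element of `signs p`. Evenness
gives each of them the sign `+1`, so nothing cancels and the coefficient counts `signs p`, up to a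
power of `1/2`. -/
theorem sandwich_apply_self_ne_zero (t : ℂ) (k l : ℕ) {p : Setoid (Fin k ⊕ Fin l)}
    (hp : IsEven p) :
    colComp t (colComp t (ePrimePow k) (diag p 1)) (ePrimePow l) (colour p 1) ≠ 0 := by
  classical
  rw [sandwich_eq]
  simp only [Finsupp.smul_apply, Finsupp.finsetSum_apply, smul_eq_mul, diag_apply_one]
  refine mul_ne_zero (pow_ne_zero _ (by norm_num)) ?_
  -- Each summand is the cast of a natural number, so that nonvanishing in `ℂ` can be deduced from
  -- positivity in `ℕ`.
  have h : ∀ (z : Fin k → ℤˣ) (w : Fin l → ℤˣ),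
      sg (Sum.elim z w : Fin k ⊕ Fin l → ℤˣ) *
        (if (Sum.elim z w : Fin k ⊕ Fin l → ℤˣ) ∈ signs p then (1 : ℂ) else 0) =
      ((if (Sum.elim z w : Fin k ⊕ Fin l → ℤˣ) ∈ signs p then 1 else 0 : ℕ) : ℂ) := by
    intro z w
    split_ifs with hf
    · rw [sg_of_isEven hp hf]; simp
    · simp
  simp only [h]
  rw [← Finset.sum_product', ← Nat.cast_sum, Nat.cast_ne_zero]
  -- The trivial labelling lies in `signs p` and contributes `1`.
  refine (Finset.sum_pos' (fun _ _ => Nat.zero_le _) ⟨(1, 1), Finset.mem_univ _, ?_⟩).ne'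
  rw [elim_one_one, if_pos (one_mem _)]
  exact one_pos

/-- The diagram of a partition with a block of odd size is killed by the idempotents. -/
theorem sandwich_eq_zero (t : ℂ) (k l : ℕ) {p : Setoid (Fin k ⊕ Fin l)} (hp : ¬ IsEven p) :
    colComp t (colComp t (ePrimePow k) (diag p 1)) (ePrimePow l) = 0 := by
  rw [isEven_iff] at hp
  push Not at hp
  -- An example of such an `f` is the function equal to `-1` on one odd block and to `1` elsewhere.
  obtain ⟨f, hf, hne⟩ := hp
  have hsg : sg f = -1 := by
    rw [sg, (Int.units_eq_one_or _).resolve_left hne]; simp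
  -- Colouring by `f` is invisible to the class because `f` is constant on blocks, yet the
  -- idempotents absorb it at the cost of the factor `sg f = -1`. The sandwich is thus equal to its
  -- negative.
  have h := sandwich_absorb t k l p f
  have hd : diag p f = diag p 1 := by
    rw [diag, diag, colour_eq.2 (by rwa [one_mul])]
  rw [hd, hsg, neg_one_smul] at h
  exact self_eq_neg.1 h

/-! ### Injectivity and range on spaces of diagrams -/

theorem omegaHom_apply (t : ℂ) (k l : ℕ) (f : EvenPart (Fin k ⊕ Fin l) →₀ ℂ)
    (q : EvenPart (Fin k ⊕ Fin l)) :
    omegaHom t k l f (colour q.1 1) = f q * (weight q.1 *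
      colComp (2 * t) (colComp (2 * t) (ePrimePow k) (diag q.1 1)) (ePrimePow l)
        (colour q.1 1)) := by
  induction f using Finsupp.induction_linear with
  | zero => simp
  | add f g hf hg => rw [map_add, Finsupp.add_apply, hf, hg, Finsupp.add_apply, add_mul]
  | single p a =>
    rw [omegaHom, Finsupp.linearCombination_single, Finsupp.smul_apply, Finsupp.smul_apply,
      smul_eq_mul, smul_eq_mul]
    by_cases h : p = q
    · rw [h, Finsupp.single_eq_same]
    · rw [sandwich_apply_of_ne _ _ _ fun e => h (Subtype.ext e),
        Finsupp.single_eq_of_ne (Ne.symm h)]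
      simp

/-- By `omegaHom_apply`, the coefficient of the image at `colour q.1 1` recovers `f q` up to a
factor that depends only on `q` and does not vanish. -/
theorem omegaHom_injective (t : ℂ) (k l : ℕ) : Function.Injective (omegaHom t k l) := by
  intro f g h
  ext q
  have hq := congrArg (fun F => F (colour q.1 1)) h
  simp only [omegaHom_apply] at hq
  exact mul_right_cancel₀
    (mul_ne_zero (weight_ne_zero _) (sandwich_apply_self_ne_zero _ _ _ q.2)) hq

/-- This is fullness at the level of diagrams. By linearity `f` may be taken to be a multiple of one
coloured diagram; its labels leave as the scalar `sg u`, and what remains is the sandwich of an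
uncoloured partition. -/
theorem sandwich_mem_range_omegaHom (t : ℂ) (k l : ℕ) (f : Coloured (Fin k ⊕ Fin l) →₀ ℂ) :
    colComp (2 * t) (colComp (2 * t) (ePrimePow k) f) (ePrimePow l) ∈
      LinearMap.range (omegaHom t k l) := by
  induction f using diag_induction with
  | zero => simp
  | add f g hf hg =>
    rw [map_add, map_add, LinearMap.add_apply]
    exact add_mem hf hg
  | smul p u a =>
    rw [map_smul, map_smul, LinearMap.smul_apply, sandwich_absorb]
    refine Submodule.smul_mem _ _ (Submodule.smul_mem _ _ ?_)
    by_cases hp : IsEven p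
    -- The inverse weight undoes the normalisation built into `omegaHom`.
    · refine ⟨Finsupp.single ⟨p, hp⟩ (weight p)⁻¹, ?_⟩
      rw [omegaHom, Finsupp.linearCombination_single, inv_smul_smul₀ (weight_ne_zero p)]
    · rw [sandwich_eq_zero _ _ _ hp]
      exact zero_mem _

end

/-! ### Passage to the additive and Karoubi envelopes -/

theorem addHom_injective {t : ℂ} {k l : ℕ} {f g : Coloured (Fin k ⊕ Fin l) →₀ ℂ}
    (h : addHom t f = addHom t g) : f = g :=
  Functor.FullyFaithful.map_injective (.ofFullyFaithful (Mat_.embedding (ParZ2 t)))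
    (X := ⟨k⟩) (Y := ⟨l⟩) h

theorem addHom_surjective {t : ℂ} {k l : ℕ} (g : addObj t k ⟶ addObj t l) :
    ∃ f : Coloured (Fin k ⊕ Fin l) →₀ ℂ, addHom t f = g :=
  (Mat_.embedding (ParZ2 t)).map_surjective (X := ⟨k⟩) (Y := ⟨l⟩) g

/-- The hypothesis `hg` is the condition that defines morphisms of the Karoubi envelope. It says
that the linear combination of diagrams behind `g` gives the same morphism as its own sandwich, and
sandwiches lie in the range of `omegaHom`. -/
theorem exists_addHom_omegaHom_eq {t : ℂ} {k l : ℕ} (g : addObj (2 * t) k ⟶ addObj (2 * t) l)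
    (hg : addHom (2 * t) (ePrimePow k) ≫ g ≫ addHom (2 * t) (ePrimePow l) = g) :
    ∃ f, addHom (2 * t) (omegaHom t k l f) = g := by
  obtain ⟨φ, rfl⟩ := addHom_surjective g
  obtain ⟨f, hf⟩ := sandwich_mem_range_omegaHom t k l φ
  refine ⟨f, ?_⟩
  rwa [addHom_comp, addHom_comp, ← colComp_assoc, ← hf] at hg

theorem Omega0_obj_injective (t : ℂ) : Function.Injective (Omega0 t).obj := by
  intro X Y h
  -- The set of ranks of the summands is an invariant of the object in a type that does not depend
  -- on the index type of the summands, so it can be transported along `h` directly. For an image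
  -- object the index type has one element, and the set is the singleton of its rank.
  have h' := congrArg (fun P : ParZ2Kar (2 * t) => Set.range fun i => (P.X.X i).rank) h
  have hX : X.rank ∈ Set.range fun i => (((Omega0 t).obj X).X.X i).rank := ⟨PUnit.unit, rfl⟩
  obtain ⟨_, hi⟩ := (h' ▸ hX : X.rank ∈ Set.range fun i => (((Omega0 t).obj Y).X.X i).rank)
  exact RepH0.ext hi.symm

theorem Omega0_faithful (t : ℂ) : (Omega0 t).Faithful where
  map_injective {X Y} _ _ h :=
    omegaHom_injective t X.rank Y.rank
      (addHom_injective (congrArg Idempotents.Karoubi.Hom.f h))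

theorem Omega0_full (t : ℂ) : (Omega0 t).Full where
  map_surjective {X Y} g := by
    -- The field `g.comm` supplies the invariance of `g.f` under the two idempotents.
    obtain ⟨f, hf⟩ := exists_addHom_omegaHom_eq g.f g.comm
    exact ⟨f, Idempotents.Karoubi.hom_ext _ _ hf⟩

end HypOct

theorem mainTheorem7 (t : ℂ) :
    Function.Injective (HypOct.Omega0 t).obj ∧ (HypOct.Omega0 t).Full ∧
      (HypOct.Omega0 t).Faithful :=
  ⟨HypOct.Omega0_obj_injective t, HypOct.Omega0_full t, HypOct.Omega0_faithful t⟩
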